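/- Let $(\Omega,\mathcal F,(\mathcal F_t)_{0\le t\le T},P)$, $0\le T<\infty$, be a filtered probability space satisfying the usual assumptions (right-continuity, and $\mathcal F_0$ contains all subsets of $P$-null sets), let $S=(S_t)_{0\le t\le T}$ be an adapted process with continuous, strictly positive paths, and let $\lambda>0$. A local martingale under a probability measure $Q$ is an adapted càdlàg process $X$ for which there are stopping times $\tau_k$ with values in $[0,T]\cup\{\infty\}$, $Q$-a.s. nondecreasing in $k$ and $Q$-a.s. equal to $\infty$ for all large $k$, such that $(1_{\{\tau_k>0\}}X_{t\wedge\tau_k})_{0\le t\le T}$ is a $Q$-martingale for every $k$. A $\lambda$-consistent price system is a pair $(Q,\widetilde S)$ of a probability measure $Q\sim P$ and a $Q$-local martingale $\widetilde S=(\widetilde S_t)_{0\le t\le T}$ such that, for every $t\in[0,T]$, $(1-\lambda)S_t\le\widetilde S_t\le S_t$ a.s. Let $\mathcal M(\lambda)$ be the set of all probability measures $Q\sim P$ for which there is $\widetilde S$ such that $(Q,\widetilde S)$ is a $\lambda$-consistent price system. Then $\mathcal M(\lambda)$ is closed under countable convex combinations: if $Q^m\in\mathcal M(\lambda)$ and $\alpha_m\ge0$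 for $m\in\mathbb N$, with $\sum_m\alpha_m=1$, then $Q:=\sum_m\alpha_mQ^m\in\mathcal M(\lambda)$. Moreover, whenever $(Q^m,\widetilde S^m)$, $m\in\mathbb N$, are $\lambda$-consistent price systems and $Q:=\sum_m\alpha_mQ^m$, there is a process $\widetilde S$ such that $(Q,\widetilde S)$ is a $\lambda$-consistent price system and, for every $t\in[0,T]$, almost surely $Z_t>0$ and $$\widetilde S_t=\sum_{m}\frac{\alpha_m\widetilde S^m_tZ^m_t}{Z_t},$$ where the series converges, $Z^m_t=E_P\big[\tfrac{dQ^m}{dP}\,\big|\,\mathcal F_t\big]$ and $Z_t=E_P\big[\tfrac{dQ}{dP}\,\big|\,\mathcal F_t\big]$. -/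

import Mathlib

open MeasureTheory ProbabilityTheory Filter Topology
open scoped NNReal ENNReal

/-- The compact time interval `[0, T]`. -/
abbrev TimeInterval (T : ℝ≥0) : Type := Set.Iic T

/-- The usual assumptions on a filtration: it is right-continuous, and the initial σ-algebra
contains every subset of a `P`-null set (`P s = 0` is read for the outer measure, so this includes
completeness of the probability space). -/
structure UsualConditions {Ω : Type*} {mΩ : MeasurableSpace Ω} {T : ℝ≥0}
    (𝓕 : Filtration (TimeInterval T) mΩ) (P : Measure Ω) : Prop where
  rightContinuous : 𝓕.IsRightContinuous
  complete : ∀ s : Set Ω, P s = 0 → MeasurableSet[𝓕 ⊥] s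

/-- A path on `[0, T]` is càdlàg: right-continuous, with finite left limits. -/
def IsCadlagPath {T : ℝ≥0} (x : TimeInterval T → ℝ) : Prop :=
  ∀ t, ContinuousWithinAt x (Set.Ici t) t ∧ ∃ l : ℝ, Tendsto x (𝓝[<] t) (𝓝 l)

/-- A càdlàg local martingale on `[0, T]`. Stopping times take values in `[0, T] ∪ {⊤}`; as `⊤` is
isolated there, `τ n → ⊤` means that `τ n = ⊤` for all large `n`, so that the whole of `[0, T]` is
exhausted. `Locally` asks that each `1_{τ n > 0} X^{τ n}` be a martingale. -/
structure IsLocalMartingale {Ω : Type*} {mΩ : MeasurableSpace Ω} {T : ℝ≥0}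
    (X : TimeInterval T → Ω → ℝ) (𝓕 : Filtration (TimeInterval T) mΩ) (Q : Measure Ω) : Prop where
  adapted : StronglyAdapted 𝓕 X
  cadlag : ∀ ω, IsCadlagPath fun t => X t ω
  locally_martingale : Locally (fun Y => Martingale Y 𝓕 Q) 𝓕 X Q

/-- `(Q, Stilde)` is a `lam`-consistent price system for the price process `S` on the filtered
probability space with measure `P`. -/
structure IsConsistentPriceSystem {Ω : Type*} {mΩ : MeasurableSpace Ω} {T : ℝ≥0}
    (P : Measure Ω) (𝓕 : Filtration (TimeInterval T) mΩ) (S : TimeInterval T → Ω → ℝ) (lam : ℝ)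
    (Q : Measure Ω) (Stilde : TimeInterval T → Ω → ℝ) : Prop where
  isProbabilityMeasure : IsProbabilityMeasure Q
  absolutelyContinuous : Q ≪ P
  absolutelyContinuous' : P ≪ Q
  isLocalMartingale : IsLocalMartingale Stilde 𝓕 Q
  bidAsk : ∀ t, ∀ᵐ ω ∂P, (1 - lam) * S t ω ≤ Stilde t ω ∧ Stilde t ω ≤ S t ω

/-- The set `M(lam)` of all measures inducing a `lam`-consistent price system. -/
def consistentMeasures {Ω : Type*} {mΩ : MeasurableSpace Ω} {T : ℝ≥0}
    (P : Measure Ω) (𝓕 : Filtration (TimeInterval T) mΩ) (S : TimeInterval T → Ω → ℝ) (lam : ℝ) :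
    Set (Measure Ω) :=
  {Q | ∃ Stilde : TimeInterval T → Ω → ℝ, IsConsistentPriceSystem P 𝓕 S lam Q Stilde}

/-- The countable mixture `∑ α_m Q^m`. -/
noncomputable def mixture {Ω : Type*} {mΩ : MeasurableSpace Ω} (α : ℕ → ℝ) (Q : ℕ → Measure Ω) :
    Measure Ω :=
  Measure.sum fun m => ENNReal.ofReal (α m) • Q m

/-- The density process `Z_t = E_P[dQ/dP | 𝓕_t]`. -/
noncomputable def densityProcess {Ω : Type*} {mΩ : MeasurableSpace Ω} {T : ℝ≥0}
    (P : Measure Ω) (𝓕 : Filtration (TimeInterval T) mΩ) (Q : Measure Ω) :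
    TimeInterval T → Ω → ℝ :=
  fun t => P[fun ω => (Q.rnDeriv P ω).toReal | 𝓕 t]

/-! The crux is a localizing sequence that serves every price system at once. Let `σ n` be the first
time `S` reaches level `n`; it depends on neither `m` nor `Q m`. Since `|Stilde m| ≤ (1 + lam) * S`,
each `Stilde m` stopped at `σ n` (and set to zero where `σ n` is the initial time) is a true `Q
m`-martingale, with a bound uniform in `m` (`IsLocalMartingale.martingale_stopped`).

For uniformly bounded martingales `Y m`, write `L m`, `L` for the densities of `Q m` and of the
mixture, so that `L = ∑ α m * L m`. Then `ξ = (∑ α m * L m * Y m ⊤) / L` has the same bound. Bayes'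
formula, applied to each term and to the mixture, identifies the conditional expectation of `ξ`
under the mixture as the required weighted series (`exists_cadlag_martingale_mixture`). A càdlàg
version exists under the usual conditions: finitely many upcrossings along dyadic times give
one-sided limits, and right limits give the version (`UsualConditions.exists_cadlag_condExp`).

The versions `X n` obtained at different levels agree before `σ n`, so they glue to one process, and
optional stopping shows that `σ n` localizes it. The bid-ask bounds survive because the weights `α m
* Z^m / Z` are nonnegative and sum to one. -/

/-! ### Dyadic discretization of time -/

section DyadicTimes

variable {T : ℝ≥0}

/-- The `k`-th dyadic time of level `j`, capped at `T`. -/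
noncomputable def dyadicTime (T : ℝ≥0) (j k : ℕ) : TimeInterval T :=
  ⟨min (k / 2 ^ j) T, Set.mem_Iic.2 (min_le_right _ _)⟩

/-- The countable set of all capped dyadic times. -/
def dyadicTimes (T : ℝ≥0) : Set (TimeInterval T) :=
  {x | ∃ j k, x = dyadicTime T j k}

/-- The first dyadic time of level `j` strictly after `t`, capped at `T`. -/
noncomputable def dyadicSucc (j : ℕ) (t : TimeInterval T) : TimeInterval T :=
  dyadicTime T j (⌊2 ^ j * (t : ℝ≥0)⌋₊ + 1)

theorem countable_dyadicTimes : (dyadicTimes T).Countable := by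
  have : dyadicTimes T = Set.range fun p : ℕ × ℕ => dyadicTime T p.1 p.2 := by
    ext x
    simp [dyadicTimes, eq_comm]
  rw [this]
  exact Set.countable_range _

theorem dyadicTime_mono (j : ℕ) : Monotone (dyadicTime T j) := by
  intro a b hab
  have : (a : ℝ≥0) ≤ b := by exact_mod_cast hab
  refine Subtype.mk_le_mk.2 (min_le_min_right _ ?_)
  gcongr

theorem exists_dyadicTime_eq_of_le {j j' : ℕ} (h : j ≤ j') (k : ℕ) :
    ∃ k', dyadicTime T j k = dyadicTime T j' k' := by
  obtain ⟨d, rfl⟩ := Nat.exists_eq_add_of_le h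
  refine ⟨k * 2 ^ d, Subtype.ext ?_⟩
  simp only [dyadicTime]
  congr 1
  push_cast
  rw [pow_add, mul_div_mul_right _ _ (by positivity)]

theorem dyadicSucc_mem (j : ℕ) (t : TimeInterval T) : dyadicSucc j t ∈ dyadicTimes T :=
  ⟨_, _, rfl⟩

theorem coe_lt_dyadic (j : ℕ) (t : ℝ≥0) : t < ((⌊2 ^ j * t⌋₊ + 1 : ℕ) : ℝ≥0) / 2 ^ j := by
  rw [lt_div_iff₀ (by positivity), mul_comm]
  push_cast
  exact Nat.lt_floor_add_one _

theorem le_dyadicSucc (j : ℕ) (t : TimeInterval T) : t ≤ dyadicSucc j t :=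
  Subtype.coe_le_coe.1 (le_min (coe_lt_dyadic j _).le t.2)

theorem lt_dyadicSucc (j : ℕ) {t : TimeInterval T} (ht : t < ⊤) : t < dyadicSucc j t :=
  Subtype.coe_lt_coe.1 (lt_min (coe_lt_dyadic j _) (Subtype.coe_lt_coe.2 ht))

@[simp] theorem dyadicSucc_top (j : ℕ) : dyadicSucc j (⊤ : TimeInterval T) = ⊤ :=
  top_le_iff.1 (le_dyadicSucc j ⊤)

theorem tendsto_dyadicSucc (t : TimeInterval T) :
    Tendsto (fun j => dyadicSucc j t) atTop (𝓝 t) := by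
  rw [tendsto_subtype_rng]
  have hlim : Tendsto (fun j : ℕ => (t : ℝ≥0) + (1 / 2) ^ j) atTop (𝓝 (t : ℝ≥0)) := by
    have := tendsto_pow_atTop_nhds_zero_of_lt_one (r := (1 / 2 : ℝ)) (by norm_num)
      (by norm_num)
    have := (NNReal.tendsto_coe (x := (0 : ℝ≥0)) (m := fun j : ℕ => (1 / 2 : ℝ≥0) ^ j)).1
      (by simpa using this)
    simpa using (tendsto_const_nhds (x := (t : ℝ≥0))).add this
  refine tendsto_of_tendsto_of_tendsto_of_le_of_le tendsto_const_nhds hlim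
    (fun j => le_dyadicSucc j t) fun j => (min_le_left _ _).trans ?_
  push_cast
  rw [div_le_iff₀ (by positivity), add_mul, ← mul_pow]
  simp only [one_div, inv_mul_cancel₀ (two_ne_zero' ℝ≥0), one_pow]
  gcongr
  rw [mul_comm]
  exact Nat.floor_le (by positivity)

theorem tendsto_dyadicSucc_nhdsGE (t : TimeInterval T) :
    Tendsto (fun j => dyadicSucc j t) atTop (𝓝[≥] t) :=
  tendsto_nhdsWithin_iff.2 ⟨tendsto_dyadicSucc t, .of_forall fun j => le_dyadicSucc j t⟩

theorem tendsto_dyadicSucc_nhdsGT {t : TimeInterval T} (ht : t < ⊤) :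
    Tendsto (fun j => dyadicSucc j t) atTop (𝓝[dyadicTimes T ∩ Set.Ioi t] t) :=
  tendsto_nhdsWithin_iff.2
    ⟨tendsto_dyadicSucc t, .of_forall fun j => ⟨dyadicSucc_mem j t, lt_dyadicSucc j ht⟩⟩

theorem neBot_nhdsWithin_dyadicTimes_inter_Ioi {t : TimeInterval T} (ht : t < ⊤) :
    (𝓝[dyadicTimes T ∩ Set.Ioi t] t).NeBot :=
  (tendsto_dyadicSucc_nhdsGT ht).neBot

/-- The discretization of a bounded stopping time from above is a stopping time. -/
theorem isStoppingTime_dyadicSucc {Ω : Type*} {mΩ : MeasurableSpace Ω}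
    {𝓕 : Filtration (TimeInterval T) mΩ} {ρ : Ω → TimeInterval T}
    (hρ : IsStoppingTime 𝓕 fun ω => (ρ ω : WithTop (TimeInterval T))) (j : ℕ) :
    IsStoppingTime 𝓕 fun ω => (dyadicSucc j (ρ ω) : WithTop (TimeInterval T)) := by
  intro t
  rcases eq_or_lt_of_le (le_top : t ≤ ⊤) with rfl | ht
  · simp
  -- The discretized time lies strictly beyond `ρ` when `ρ < ⊤`, so the event is a strict inequality
  -- at the last grid point not after `t`. The case `t = ⊤` is separate because the cap at `T`
  -- breaks this equivalence.
  have key : ∀ ω, dyadicSucc j (ρ ω) ≤ t ↔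
      ρ ω < dyadicTime T j ⌊2 ^ j * (t : ℝ≥0)⌋₊ := by
    intro ω
    have hT : (t : ℝ≥0) < T := ht
    have h2 : (0 : ℝ≥0) < 2 ^ j := by positivity
    have hfl : ((⌊2 ^ j * (t : ℝ≥0)⌋₊ : ℕ) : ℝ≥0) / 2 ^ j ≤ t := by
      rw [div_le_iff₀ h2, mul_comm (t : ℝ≥0)]
      exact Nat.floor_le (by positivity)
    rw [← Subtype.coe_le_coe, ← Subtype.coe_lt_coe]
    simp only [dyadicSucc, dyadicTime]
    rw [min_eq_left (hfl.trans hT.le), min_le_iff, or_iff_left hT.not_ge,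
      div_le_iff₀ h2, lt_div_iff₀ h2, mul_comm (t : ℝ≥0), mul_comm (ρ ω : ℝ≥0),
      ← Nat.le_floor_iff (by positivity), Nat.succ_le_iff, ← Nat.floor_lt (by positivity)]
  have hle : dyadicTime T j ⌊2 ^ j * (t : ℝ≥0)⌋₊ ≤ t := by
    refine Subtype.coe_le_coe.1 ((min_le_left _ _).trans ?_)
    rw [div_le_iff₀ (by positivity), mul_comm (t : ℝ≥0)]
    exact Nat.floor_le (by positivity)
  have := 𝓕.mono hle _ (hρ.measurableSet_lt (dyadicTime T j ⌊2 ^ j * (t : ℝ≥0)⌋₊))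
  simpa only [WithTop.coe_le_coe, WithTop.coe_lt_coe, key] using this

end DyadicTimes

/-! ### Upcrossings along dyadic times and one-sided limits -/

section Crossings

variable {T : ℝ≥0}

/-- `HasUpcrossings g a b K v`: along the dyadic times strictly after `v`, the path `g` passes `K`
times from below `a` to above `b`. -/
def HasUpcrossings (g : TimeInterval T → ℝ) (a b : ℝ) : ℕ → TimeInterval T → Prop
  | 0, _ => True
  | K + 1, v => ∃ p ∈ dyadicTimes T, ∃ q ∈ dyadicTimes T,
      v < p ∧ p < q ∧ g p < a ∧ b < g q ∧ HasUpcrossings g a b K q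

/-- A grid containing all the chosen points sees every one of these upcrossings. The condition on
`N` says that grid indices after `v` start no earlier than `N`, so the `K` new upcrossings add to
those already counted before `N`; this is what makes the induction close. -/
theorem HasUpcrossings.le_upcrossingsBefore {Ω : Type*} {X : TimeInterval T → Ω → ℝ} {ω : Ω}
    {a b : ℝ} (hab : a < b) {K : ℕ} {v : TimeInterval T}
    (h : HasUpcrossings (fun t => X t ω) a b K v) :
    ∃ j₀, ∀ j ≥ j₀, ∀ N, (∀ n, v < dyadicTime T j n → N ≤ n) →
      ∃ N', upcrossingsBefore a b (fun k => X (dyadicTime T j k)) N ω + K ≤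
        upcrossingsBefore a b (fun k => X (dyadicTime T j k)) N' ω := by
  induction K generalizing v with
  | zero => exact ⟨0, fun j _ N _ => ⟨N, le_rfl⟩⟩
  | succ K ih =>
    obtain ⟨p, ⟨jp, kp, rfl⟩, q, ⟨jq, kq, rfl⟩, hvp, hpq, hpa, hqb, hK⟩ := h
    obtain ⟨j₀, hj₀⟩ := ih hK
    refine ⟨max j₀ (max jp jq), fun j hj N hN => ?_⟩
    obtain ⟨n₁, h₁⟩ := exists_dyadicTime_eq_of_le (T := T) (j := jp) (j' := j) (by omega) kp
    obtain ⟨n₂, h₂⟩ := exists_dyadicTime_eq_of_le (T := T) (j := jq) (j' := j) (by omega) kq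
    rw [h₁] at hvp hpa hpq
    rw [h₂] at hpq hqb
    have hlt : n₁ < n₂ := by
      by_contra! hc
      exact hpq.not_ge (dyadicTime_mono j hc)
    -- The grid points after `q` have index at least `n₂ + 1`, and one more upcrossing is completed
    -- before that index.
    obtain ⟨N', hN'⟩ := hj₀ j (by omega) (n₂ + 1) fun n hn => by
      by_contra! hc
      rw [h₂] at hn
      exact hn.not_ge (dyadicTime_mono j (by omega))
    refine ⟨N', ?_⟩
    have := upcrossingsBefore_lt_of_exists_upcrossing (f := fun k => X (dyadicTime T j k))
      (ω := ω) hab (hN n₁ hvp) hpa hlt.le hqb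
    omega

theorem HasUpcrossings.le_upcrossings {Ω : Type*} {X : TimeInterval T → Ω → ℝ} {ω : Ω}
    {a b : ℝ} (hab : a < b) {K : ℕ} {v : TimeInterval T}
    (h : HasUpcrossings (fun t => X t ω) a b K v) :
    ∀ᶠ j in atTop, (K : ℝ≥0∞) ≤ upcrossings a b (fun k => X (dyadicTime T j k)) ω := by
  obtain ⟨j₀, hj₀⟩ := h.le_upcrossingsBefore hab
  filter_upwards [eventually_ge_atTop j₀] with j hj
  obtain ⟨N', hN'⟩ := hj₀ j hj 0 fun _ _ => Nat.zero_le _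
  refine le_trans ?_ (le_iSup _ N')
  exact_mod_cast (Nat.le_add_left _ _).trans hN'

/-- Each further upcrossing is inserted between `t` and those already found, so the chain grows
backwards in time and its starting point `v` must be existential. From the left, the chain grows
forwards and any starting point works. -/
theorem exists_hasUpcrossings_of_frequently_right {g : TimeInterval T → ℝ} {a b : ℝ}
    {t : TimeInterval T} (ha : ∃ᶠ x in 𝓝[dyadicTimes T ∩ Set.Ioi t] t, g x < a)
    (hb : ∃ᶠ x in 𝓝[dyadicTimes T ∩ Set.Ioi t] t, b < g x) (K : ℕ) :
    ∃ v > t, HasUpcrossings g a b K v := by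
  have near : ∀ u > t, ∀ᶠ x in 𝓝[dyadicTimes T ∩ Set.Ioi t] t, x ∈ dyadicTimes T ∧ t < x ∧ x < u :=
    fun u hu => by
      filter_upwards [self_mem_nhdsWithin, nhdsWithin_le_nhds (gt_mem_nhds hu)] with x hx hxu
      exact ⟨hx.1, hx.2, hxu⟩
  induction K with
  | zero =>
    obtain ⟨x, hx⟩ := (ha.and_eventually self_mem_nhdsWithin).exists
    exact ⟨x, hx.2.2, trivial⟩
  | succ K ih =>
    obtain ⟨v, hv, hK⟩ := ih
    obtain ⟨q, hqb, hqD, htq, hqv⟩ := (hb.and_eventually (near v hv)).exists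
    obtain ⟨p, hpa, hpD, htp, hpq⟩ := (ha.and_eventually (near q htq)).exists
    obtain ⟨w, -, -, htw, hwp⟩ := (ha.and_eventually (near p htp)).exists
    refine ⟨w, htw, p, hpD, q, hqD, hwp, hpq, hpa, hqb, ?_⟩
    cases K with
    | zero => trivial
    | succ K =>
      obtain ⟨p', h1, q', h2, h3, h4⟩ := hK
      exact ⟨p', h1, q', h2, hqv.trans h3, h4⟩

theorem hasUpcrossings_of_frequently_left {g : TimeInterval T → ℝ} {a b : ℝ}
    {t : TimeInterval T} (ha : ∃ᶠ x in 𝓝[dyadicTimes T ∩ Set.Iio t] t, g x < a)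
    (hb : ∃ᶠ x in 𝓝[dyadicTimes T ∩ Set.Iio t] t, b < g x) (K : ℕ) {u : TimeInterval T}
    (hu : u < t) : HasUpcrossings g a b K u := by
  have near : ∀ u < t, ∀ᶠ x in 𝓝[dyadicTimes T ∩ Set.Iio t] t, x ∈ dyadicTimes T ∧ u < x ∧ x < t :=
    fun u hu => by
      filter_upwards [self_mem_nhdsWithin, nhdsWithin_le_nhds (lt_mem_nhds hu)] with x hx hxu
      exact ⟨hx.1, hxu, hx.2⟩
  induction K generalizing u with
  | zero => trivial
  | succ K ih =>
    obtain ⟨p, hpa, hpD, hup, hpt⟩ := (ha.and_eventually (near u hu)).exists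
    obtain ⟨q, hqb, hqD, hpq, hqt⟩ := (hb.and_eventually (near p hpt)).exists
    exact ⟨p, hpD, q, hqD, hup, hpq, hpa, hqb, ih hqt⟩

/-- The path `g` has, along the dyadic times, only finitely many upcrossings of each rational
interval. -/
def FiniteUpcrossings (g : TimeInterval T → ℝ) : Prop :=
  ∀ a b : ℚ, a < b → ∃ K : ℕ, ∀ v, ¬ HasUpcrossings g a b K v

theorem FiniteUpcrossings.exists_tendsto_right {g : TimeInterval T → ℝ} {C : ℝ}
    (hg : FiniteUpcrossings g) (hC : ∀ d ∈ dyadicTimes T, |g d| ≤ C) (t : TimeInterval T) :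
    ∃ l, Tendsto g (𝓝[dyadicTimes T ∩ Set.Ioi t] t) (𝓝 l) := by
  have hD : ∀ᶠ x in 𝓝[dyadicTimes T ∩ Set.Ioi t] t, |g x| ≤ C := by
    filter_upwards [self_mem_nhdsWithin] with x hx using hC x hx.1
  refine tendsto_of_no_upcrossings (s := Set.range ((↑) : ℚ → ℝ)) Rat.denseRange_cast ?_ ?_ ?_
  · rintro _ ⟨a, rfl⟩ _ ⟨b, rfl⟩ hab ⟨ha, hb⟩
    obtain ⟨K, hK⟩ := hg a b (by exact_mod_cast hab)
    obtain ⟨v, -, hv⟩ := exists_hasUpcrossings_of_frequently_right ha hb K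
    exact hK v hv
  · exact ⟨C, by simpa using hD.mono fun x hx => (abs_le.1 hx).2⟩
  · exact ⟨-C, by simpa using hD.mono fun x hx => (abs_le.1 hx).1⟩

theorem FiniteUpcrossings.exists_tendsto_left {g : TimeInterval T → ℝ} {C : ℝ}
    (hg : FiniteUpcrossings g) (hC : ∀ d ∈ dyadicTimes T, |g d| ≤ C) (t : TimeInterval T) :
    ∃ l, Tendsto g (𝓝[dyadicTimes T ∩ Set.Iio t] t) (𝓝 l) := by
  have hD : ∀ᶠ x in 𝓝[dyadicTimes T ∩ Set.Iio t] t, |g x| ≤ C := by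
    filter_upwards [self_mem_nhdsWithin] with x hx using hC x hx.1
  refine tendsto_of_no_upcrossings (s := Set.range ((↑) : ℚ → ℝ)) Rat.denseRange_cast ?_ ?_ ?_
  · rintro _ ⟨a, rfl⟩ _ ⟨b, rfl⟩ hab ⟨ha, hb⟩
    obtain ⟨K, hK⟩ := hg a b (by exact_mod_cast hab)
    obtain ⟨x, hx⟩ := (ha.and_eventually self_mem_nhdsWithin).exists
    exact hK x (hasUpcrossings_of_frequently_left ha hb K hx.2.2)
  · exact ⟨C, by simpa using hD.mono fun x hx => (abs_le.1 hx).2⟩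
  · exact ⟨-C, by simpa using hD.mono fun x hx => (abs_le.1 hx).1⟩

/-- A path that has one-sided limits along the dyadic times becomes càdlàg when it is replaced by
its right limits. -/
theorem isCadlagPath_of_tendsto_right {g x : TimeInterval T → ℝ}
    (hr : ∀ t < ⊤, Tendsto g (𝓝[dyadicTimes T ∩ Set.Ioi t] t) (𝓝 (x t)))
    (hl : ∀ t, ∃ l, Tendsto g (𝓝[dyadicTimes T ∩ Set.Iio t] t) (𝓝 l)) : IsCadlagPath x := by
  -- Right limits stay in any closed set that contains the dyadic values, which is why closed
  -- neighbourhood bases are used below.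
  have key : ∀ (W : Set ℝ) (u v : TimeInterval T), IsClosed W →
      (∀ d ∈ dyadicTimes T, u < d → d < v → g d ∈ W) → ∀ s, u < s → s < v → x s ∈ W := by
    intro W u v hW h s hus hsv
    have hs := hsv.trans_le le_top
    have := neBot_nhdsWithin_dyadicTimes_inter_Ioi hs
    refine hW.mem_of_tendsto (hr s hs) ?_
    filter_upwards [self_mem_nhdsWithin, nhdsWithin_le_nhds (gt_mem_nhds hsv)] with d hd hdv
    exact h d hd.1 (hus.trans hd.2) hdv
  intro t
  constructor
  · rcases eq_or_lt_of_le (le_top : t ≤ ⊤) with rfl | ht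
    · rw [Set.Ici_top]
      exact continuousWithinAt_singleton
    · refine continuousWithinAt_Ioi_iff_Ici.1 ?_
      refine ((closed_nhds_basis (x t)).tendsto_right_iff).2 fun W ⟨hW, hWc⟩ => ?_
      have := (hr t ht) hW
      rw [mem_map, mem_nhdsWithin] at this
      obtain ⟨U, hU, htU, hsub⟩ := this
      obtain ⟨v, hv, hvU⟩ := exists_Ico_subset_of_mem_nhds (hU.mem_nhds htU) ⟨⊤, ht⟩
      filter_upwards [Ioo_mem_nhdsGT hv] with s hs
      exact key W t v hWc (fun d hd h1 h2 => hsub ⟨hvU ⟨h1.le, h2⟩, hd, h1⟩) s hs.1 hs.2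
  · obtain ⟨l, hl⟩ := hl t
    refine ⟨l, ?_⟩
    rcases eq_or_lt_of_le (bot_le : ⊥ ≤ t) with rfl | ht
    · simp
    refine ((closed_nhds_basis l).tendsto_right_iff).2 fun W ⟨hW, hWc⟩ => ?_
    have := hl hW
    rw [mem_map, mem_nhdsWithin] at this
    obtain ⟨U, hU, htU, hsub⟩ := this
    obtain ⟨v, hv, hvU⟩ := exists_Ioc_subset_of_mem_nhds (hU.mem_nhds htU) ⟨⊥, ht⟩
    filter_upwards [Ioo_mem_nhdsLT hv] with s hs
    exact key W v t hWc (fun d hd h1 h2 => hsub ⟨hvU ⟨h1, h2.le⟩, hd, h2⟩) s hs.1 hs.2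

end Crossings

/-! ### Càdlàg modifications of bounded martingales -/

section Regularization

variable {Ω : Type*} {mΩ : MeasurableSpace Ω} {T : ℝ≥0} {Q : Measure Ω}
  {𝓕 : Filtration (TimeInterval T) mΩ}

/-- The filtration sampled at the dyadic times of level `j`. -/
noncomputable def dyadicFiltration (𝓕 : Filtration (TimeInterval T) mΩ) (j : ℕ) :
    Filtration ℕ mΩ where
  seq k := 𝓕 (dyadicTime T j k)
  mono' _ _ h := 𝓕.mono (dyadicTime_mono j h)
  le' _ := 𝓕.le _

theorem MeasureTheory.Martingale.dyadic {N : TimeInterval T → Ω → ℝ} (hN : Martingale N 𝓕 Q)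
    (j : ℕ) : Martingale (fun k => N (dyadicTime T j k)) (dyadicFiltration 𝓕 j) Q :=
  ⟨fun _ => hN.1 _, fun _ _ h => hN.2 _ _ (dyadicTime_mono j h)⟩

/-- Doob's inequality bounds the expected number of upcrossings on every grid by the same constant,
and Fatou makes the liminf over the grids almost surely finite. A chain of `K` dyadic upcrossings is
seen by all fine grids, so it forces this liminf to be at least `K`. -/
theorem ae_finiteUpcrossings [IsProbabilityMeasure Q] {N : TimeInterval T → Ω → ℝ}
    (hN : Martingale N 𝓕 Q) {C : ℝ} (hC : ∀ t, ∀ᵐ ω ∂Q, |N t ω| ≤ C) :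
    ∀ᵐ ω ∂Q, FiniteUpcrossings fun t => N t ω := by
  simp only [FiniteUpcrossings, ae_all_iff]
  intro a b hab
  have hab' : (a : ℝ) < b := by exact_mod_cast hab
  let U : ℕ → Ω → ℝ≥0∞ := fun j => upcrossings a b fun k => N (dyadicTime T j k)
  have hU : ∀ j, ENNReal.ofReal (b - a) * ∫⁻ ω, U j ω ∂Q ≤ ENNReal.ofReal (C + |(a : ℝ)|) := by
    intro j
    refine ((hN.dyadic j).submartingale.mul_lintegral_upcrossings_le_lintegral_pos_part
      (a : ℝ) b).trans (iSup_le fun k => ?_)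
    calc ∫⁻ ω, ENNReal.ofReal ((N (dyadicTime T j k) ω - a)⁺) ∂Q
        ≤ ∫⁻ _, ENNReal.ofReal (C + |(a : ℝ)|) ∂Q := by
          refine lintegral_mono_ae ?_
          filter_upwards [hC (dyadicTime T j k)] with ω hω
          refine ENNReal.ofReal_le_ofReal ?_
          have h1 := abs_le.1 hω
          have h2 := neg_abs_le (a : ℝ)
          have h3 := abs_nonneg (a : ℝ)
          exact sup_le (by linarith) (by linarith [abs_nonneg (N (dyadicTime T j k) ω)])
      _ = _ := by simp
  have hpos : ENNReal.ofReal (b - a : ℝ) ≠ 0 := by simpa using hab'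
  have hU' : ∀ j, ∫⁻ ω, U j ω ∂Q ≤ ENNReal.ofReal (C + |(a : ℝ)|) / ENNReal.ofReal (b - a) :=
    fun j => by
      rw [ENNReal.le_div_iff_mul_le (.inl hpos) (.inl ENNReal.ofReal_ne_top), mul_comm]
      exact hU j
  have hmeas : ∀ j, Measurable (U j) := fun j =>
    (hN.dyadic j).submartingale.stronglyAdapted.measurable_upcrossings hab'
  have hfin : ∫⁻ ω, liminf (fun j => U j ω) atTop ∂Q ≠ ∞ := by
    refine ne_top_of_le_ne_top (b := ENNReal.ofReal (C + |(a : ℝ)|) / ENNReal.ofReal (b - a))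
      (ENNReal.div_ne_top ENNReal.ofReal_ne_top hpos)
      ((lintegral_liminf_le hmeas).trans ?_)
    exact liminf_le_of_frequently_le' (.of_forall hU')
  filter_upwards [ae_lt_top (Measurable.liminf hmeas) hfin] with ω hω
  obtain ⟨K, hK⟩ := ENNReal.exists_nat_gt hω.ne
  refine ⟨K, fun v hv => ?_⟩
  have := le_liminf_of_le (by isBoundedDefault) (hv.le_upcrossings hab')
  exact this.not_gt hK

theorem UsualConditions.measurableSet_of_null (h : UsualConditions 𝓕 Q) (t : TimeInterval T)
    {s : Set Ω} (hs : Q s = 0) : MeasurableSet[𝓕 t] s :=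
  𝓕.mono bot_le _ (h.complete s hs)

theorem UsualConditions.stronglyMeasurable_of_forall_gt (h : UsualConditions 𝓕 Q)
    {t : TimeInterval T} (ht : t < ⊤) {f : Ω → ℝ}
    (hf : ∀ u > t, StronglyMeasurable[𝓕 u] f) : StronglyMeasurable[𝓕 t] f := by
  have := h.rightContinuous
  refine Measurable.stronglyMeasurable fun B hB => ?_
  refine Filtration.IsRightContinuous.measurableSet ?_
  rw [Filtration.rightCont_eq_of_not_isMax _ (by simpa using ht.ne)]
  simp only [MeasurableSpace.measurableSet_iInf]
  exact fun u hu => (hf u hu).measurable hB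

/-- **Regularization.** Under the usual conditions, a martingale closed by a bounded random
variable has an adapted càdlàg modification. -/
theorem UsualConditions.exists_cadlag_condExp [IsProbabilityMeasure Q] (h : UsualConditions 𝓕 Q)
    {ξ : Ω → ℝ} {C : ℝ} (hC : ∀ᵐ ω ∂Q, |ξ ω| ≤ C) :
    ∃ X : TimeInterval T → Ω → ℝ, StronglyAdapted 𝓕 X ∧
      (∀ ω, IsCadlagPath fun t => X t ω) ∧ ∀ t, X t =ᵐ[Q] Q[ξ | 𝓕 t] := by
  classical
  set N : TimeInterval T → Ω → ℝ := fun t => Q[ξ | 𝓕 t] with hN_def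
  have hN : Martingale N 𝓕 Q := martingale_condExp _ _ _
  have hNC : ∀ t, ∀ᵐ ω ∂Q, |N t ω| ≤ C := fun t => ae_bdd_abs_condExp_of_ae_bdd_abs hC
  -- The complement of `G` is null, hence lies in every `𝓕 t` by completeness; setting paths to zero
  -- there preserves adaptedness.
  let G : Set Ω := {ω | (∀ d ∈ dyadicTimes T, |N d ω| ≤ C) ∧ FiniteUpcrossings fun t => N t ω}
  have hG : ∀ᵐ ω ∂Q, ω ∈ G :=
    ((ae_ball_iff countable_dyadicTimes).2 fun d _ => hNC d).and (ae_finiteUpcrossings hN hNC)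
  let X : TimeInterval T → Ω → ℝ := fun t ω =>
    if ω ∈ G then limUnder atTop fun j => N (dyadicSucc j t) ω else 0
  have hXr : ∀ ω ∈ G, ∀ t < ⊤,
      Tendsto (fun s => N s ω) (𝓝[dyadicTimes T ∩ Set.Ioi t] t) (𝓝 (X t ω)) := by
    intro ω hω t ht
    obtain ⟨l, hl⟩ := hω.2.exists_tendsto_right hω.1 t
    have : X t ω = l := by
      simp only [X, if_pos hω]
      exact (hl.comp (tendsto_dyadicSucc_nhdsGT ht)).limUnder_eq
    rwa [this]
  have hXlim : ∀ ω ∈ G, ∀ t, Tendsto (fun j => N (dyadicSucc j t) ω) atTop (𝓝 (X t ω)) := by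
    intro ω hω t
    rcases eq_or_lt_of_le (le_top : t ≤ ⊤) with rfl | ht
    · have : X ⊤ ω = N ⊤ ω := by
        simp only [X, if_pos hω, dyadicSucc_top]
        exact tendsto_const_nhds.limUnder_eq
      simp [this]
    · exact (hXr ω hω t ht).comp (tendsto_dyadicSucc_nhdsGT ht)
  have hGm : ∀ t, MeasurableSet[𝓕 t] G := fun t =>
    .of_compl (h.measurableSet_of_null t (mem_ae_iff.1 hG))
  have hXind : ∀ t ω, Tendsto (fun j => G.indicator (N (dyadicSucc j t)) ω) atTop
      (𝓝 (X t ω)) := by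
    intro t ω
    by_cases hω : ω ∈ G
    · simpa [hω] using hXlim ω hω t
    · simp [hω, X]
  have hXad : StronglyAdapted 𝓕 X := by
    intro t
    rcases eq_or_lt_of_le (le_top : t ≤ ⊤) with rfl | ht
    · refine stronglyMeasurable_of_tendsto (m := 𝓕 ⊤) (u := atTop)
        (f := fun j => G.indicator (N (dyadicSucc j ⊤))) (fun j => ?_)
        (tendsto_pi_nhds.2 (hXind ⊤))
      exact ((hN.1 _).mono (𝓕.mono le_top)).indicator (hGm _)
    · refine h.stronglyMeasurable_of_forall_gt ht fun u hu => ?_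
      obtain ⟨J, hJ⟩ := eventually_atTop.1 ((tendsto_dyadicSucc t).eventually (gt_mem_nhds hu))
      refine stronglyMeasurable_of_tendsto (m := 𝓕 u) (u := atTop)
        (f := fun j => G.indicator (N (dyadicSucc (j + J) t))) (fun j => ?_)
        (tendsto_pi_nhds.2 fun ω => (hXind t ω).comp (tendsto_add_atTop_nat J))
      exact ((hN.1 _).mono (𝓕.mono (hJ _ (Nat.le_add_left _ _)).le)).indicator (hGm _)
  refine ⟨X, hXad, fun ω => ?_, fun t => ?_⟩
  · by_cases hω : ω ∈ G
    · exact isCadlagPath_of_tendsto_right (hXr ω hω) fun t => hω.2.exists_tendsto_left hω.1 t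
    · have : (fun t => X t ω) = fun _ => 0 := by
        funext t
        simp [X, hω]
      rw [this]
      exact fun t => ⟨continuousWithinAt_const, 0, tendsto_const_nhds⟩
  · have hXi : Integrable (X t) Q := by
      refine Integrable.of_bound (hXad.stronglyMeasurable).aestronglyMeasurable C ?_
      filter_upwards [hG] with ω hω
      refine le_of_tendsto (hXlim ω hω t).norm (.of_forall fun j => ?_)
      exact hω.1 _ (dyadicSucc_mem j t)
    -- Given `𝓕 t`, all `N (dyadicSucc j t)` have conditional expectation `N t`; bounded convergence
    -- passes this to `X t`, which is itself `𝓕 t`-measurable.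
    have hlim : Q[X t | 𝓕 t] =ᵐ[Q] Q[N t | 𝓕 t] := by
      refine tendsto_condExp_unique (fun j => N (dyadicSucc j t)) (fun _ => N t) _ _
        (fun j => integrable_condExp) (fun _ => integrable_condExp)
        (hG.mono fun ω hω => hXlim ω hω t) (.of_forall fun _ => tendsto_const_nhds)
        (fun _ => C) (integrable_const _) (fun _ => C) (integrable_const _)
        (fun j => hNC _) (fun _ => hNC _) fun j => ?_
      exact (hN.2 _ _ (le_dyadicSucc j t)).trans (hN.2 _ _ le_rfl).symm
    rw [condExp_of_stronglyMeasurable (𝓕.le t) (hXad t) hXi] at hlim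
    exact hlim.trans (hN.2 _ _ le_rfl)

end Regularization

/-! ### Optional stopping in continuous time -/

section OptionalStopping

variable {Ω : Type*} {mΩ : MeasurableSpace Ω} {T : ℝ≥0} {Q : Measure Ω}
  {𝓕 : Filtration (TimeInterval T) mΩ} {X : TimeInterval T → Ω → ℝ}
  {τ : Ω → WithTop (TimeInterval T)}

/-- The time `t ∧ τ`, as an element of `[0, T]`. -/
noncomputable def stopAt (τ : Ω → WithTop (TimeInterval T)) (t : TimeInterval T) (ω : Ω) :
    TimeInterval T :=
  (min (t : WithTop (TimeInterval T)) (τ ω)).untopA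

theorem coe_stopAt (t : TimeInterval T) (ω : Ω) :
    (stopAt τ t ω : WithTop (TimeInterval T)) = min (t : WithTop (TimeInterval T)) (τ ω) := by
  rw [stopAt, WithTop.untopA_eq_untop
    (ne_top_of_le_ne_top WithTop.coe_ne_top (min_le_left _ _)), WithTop.coe_untop]

theorem stopAt_le (t : TimeInterval T) (ω : Ω) : stopAt τ t ω ≤ t := by
  rw [← WithTop.coe_le_coe, coe_stopAt]
  exact min_le_left _ _

theorem stopAt_of_le {t : TimeInterval T} {ω : Ω} (h : (t : WithTop (TimeInterval T)) ≤ τ ω) :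
    stopAt τ t ω = t := by
  rw [← WithTop.coe_inj, coe_stopAt, min_eq_left h]

theorem stoppedProcess_eq_stopAt (t : TimeInterval T) (ω : Ω) :
    stoppedProcess X τ t ω = X (stopAt τ t ω) ω := rfl

theorem isStoppingTime_stopAt (hτ : IsStoppingTime 𝓕 τ) (t : TimeInterval T) :
    IsStoppingTime 𝓕 fun ω => (stopAt τ t ω : WithTop (TimeInterval T)) := by
  simp only [coe_stopAt, min_comm]
  exact hτ.min_const t

theorem stronglyMeasurable_of_countable_range (hX : StronglyAdapted 𝓕 X) {t : TimeInterval T}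
    {ρ : Ω → TimeInterval T} (hρt : ∀ ω, ρ ω ≤ t) (hc : (Set.range ρ).Countable)
    (hm : ∀ d ≤ t, MeasurableSet[𝓕 t] {ω | ρ ω = d}) :
    StronglyMeasurable[𝓕 t] fun ω => X (ρ ω) ω := by
  refine Measurable.stronglyMeasurable fun B hB => ?_
  have : (fun ω => X (ρ ω) ω) ⁻¹' B = ⋃ d ∈ Set.range ρ, {ω | ρ ω = d} ∩ X d ⁻¹' B := by
    ext ω
    simp only [Set.mem_preimage, Set.mem_iUnion, Set.mem_inter_iff, Set.mem_ofPred_eq, exists_prop]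
    exact ⟨fun h => ⟨ρ ω, ⟨ω, rfl⟩, rfl, h⟩, fun ⟨d, _, h, hd⟩ => h ▸ hd⟩
  rw [this]
  refine MeasurableSet.biUnion hc fun d hd => ?_
  obtain ⟨ω, rfl⟩ := hd
  exact (hm _ (hρt ω)).inter (((hX _).mono (𝓕.mono (hρt ω))).measurable hB)

theorem countable_range_dyadicSucc (j : ℕ) (ρ : Ω → TimeInterval T) :
    (Set.range fun ω => dyadicSucc j (ρ ω)).Countable :=
  countable_dyadicTimes.mono (by rintro _ ⟨ω, rfl⟩; exact dyadicSucc_mem j _)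

/-- `ρ` is approximated from above by countably valued stopping times. Capping them at `t` keeps the
sampled values `𝓕 t`-measurable, without right-continuity of the filtration. -/
theorem stronglyMeasurable_of_isStoppingTime (hX : StronglyAdapted 𝓕 X)
    (hc : ∀ ω t, ContinuousWithinAt (fun s => X s ω) (Set.Ici t) t) {ρ : Ω → TimeInterval T}
    (hρ : IsStoppingTime 𝓕 fun ω => (ρ ω : WithTop (TimeInterval T))) {t : TimeInterval T}
    (hρt : ∀ ω, ρ ω ≤ t) : StronglyMeasurable[𝓕 t] fun ω => X (ρ ω) ω := by
  refine stronglyMeasurable_of_tendsto (m := 𝓕 t) (u := atTop)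
    (f := fun j ω => X (min (dyadicSucc j (ρ ω)) t) ω) (fun j => ?_)
    (tendsto_pi_nhds.2 fun ω => ?_)
  · have hst := (isStoppingTime_dyadicSucc hρ j).min_const t
    have hcount : (Set.range fun ω => min (dyadicSucc j (ρ ω)) t).Countable :=
      ((countable_range_dyadicSucc j ρ).image fun x => min x t).mono (by
        rintro _ ⟨ω, rfl⟩
        exact ⟨_, ⟨ω, rfl⟩, rfl⟩)
    refine stronglyMeasurable_of_countable_range hX (fun ω => min_le_right _ _) hcount
      fun d hd => ?_
    have := 𝓕.mono hd _ (hst.measurableSet_eq_of_countable_range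
      ((hcount.image WithTop.some).mono (by
        rintro _ ⟨ω, rfl⟩
        exact ⟨_, ⟨ω, rfl⟩, by simp⟩)) d)
    simpa only [← WithTop.coe_min, WithTop.coe_inj] using this
  · refine (hc ω (ρ ω)).tendsto.comp (tendsto_nhdsWithin_iff.2 ⟨?_, .of_forall fun j =>
      le_min (le_dyadicSucc j _) (hρt ω)⟩)
    simpa [hρt ω] using (tendsto_dyadicSucc (ρ ω)).min (tendsto_const_nhds (x := t))

/-- Stopping preserves adaptedness of right-continuous processes. -/
theorem stronglyAdapted_stoppedProcess_of_rightContinuous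
    (hX : StronglyAdapted 𝓕 X)
    (hc : ∀ ω t, ContinuousWithinAt (fun s => X s ω) (Set.Ici t) t) (hτ : IsStoppingTime 𝓕 τ) :
    StronglyAdapted 𝓕 (stoppedProcess X τ) := fun t =>
  stronglyMeasurable_of_isStoppingTime hX hc (isStoppingTime_stopAt hτ t) (stopAt_le t)

/-- A right-continuous martingale on a compact time interval, evaluated at a stopping time, is
integrable and has the expectation of its terminal value. -/
theorem MeasureTheory.Martingale.integral_stoppingTime [IsFiniteMeasure Q]
    (hX : Martingale X 𝓕 Q)
    (hc : ∀ ω t, ContinuousWithinAt (fun s => X s ω) (Set.Ici t) t) {ρ : Ω → TimeInterval T}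
    (hρ : IsStoppingTime 𝓕 fun ω => (ρ ω : WithTop (TimeInterval T))) :
    Integrable (fun ω => X (ρ ω) ω) Q ∧ ∫ ω, X (ρ ω) ω ∂Q = ∫ ω, X ⊤ ω ∂Q := by
  have hst := isStoppingTime_dyadicSucc hρ
  have hle : ∀ j ω, (dyadicSucc j (ρ ω) : WithTop (TimeInterval T)) ≤
      ((⊤ : TimeInterval T) : WithTop (TimeInterval T)) := fun j ω =>
    WithTop.coe_le_coe.2 le_top
  have hV : ∀ j, (fun ω => X (dyadicSucc j (ρ ω)) ω) =ᵐ[Q] Q[X ⊤ | (hst j).measurableSpace] := by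
    intro j
    refine hX.stoppedValue_ae_eq_condExp_of_le_const_of_countable_range (hst j) (hle j) ?_
    exact ((countable_range_dyadicSucc j ρ).image WithTop.some).mono (by
      rintro _ ⟨ω, rfl⟩
      exact ⟨_, ⟨ω, rfl⟩, rfl⟩)
  -- Conditional expectations of the single variable `X ⊤` are uniformly integrable, so almost sure
  -- convergence upgrades to convergence in L¹.
  have hUI : UniformIntegrable (fun j ω => X (dyadicSucc j (ρ ω)) ω) 1 Q :=
    ((hX.integrable ⊤).uniformIntegrable_condExp fun j => (hst j).measurableSpace_le).ae_eq
      fun j => (hV j).symm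
  have hlim : ∀ᵐ ω ∂Q, Tendsto (fun j => X (dyadicSucc j (ρ ω)) ω) atTop (𝓝 (X (ρ ω) ω)) :=
    .of_forall fun ω => (hc ω (ρ ω)).tendsto.comp (tendsto_dyadicSucc_nhdsGE _)
  have hint : Integrable (fun ω => X (ρ ω) ω) Q := hUI.integrable_of_ae_tendsto hlim
  refine ⟨hint, ?_⟩
  have hL1 := tendsto_Lp_finite_of_tendsto_ae le_rfl ENNReal.one_ne_top hUI.1
    (memLp_one_iff_integrable.2 hint) hUI.2.1 hlim
  have h1 := tendsto_integral_of_L1' _ hint.1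
    (.of_forall fun j => memLp_one_iff_integrable.1 (hUI.memLp j)) hL1
  refine tendsto_nhds_unique h1 (tendsto_const_nhds.congr fun j => ?_)
  rw [integral_congr_ae (hV j), integral_condExp]

/-- **Optional stopping** for right-continuous martingales on a compact time interval. -/
theorem martingale_stoppedProcess_of_rightContinuous [IsFiniteMeasure Q]
    (hX : Martingale X 𝓕 Q)
    (hc : ∀ ω t, ContinuousWithinAt (fun s => X s ω) (Set.Ici t) t) (hτ : IsStoppingTime 𝓕 τ) :
    Martingale (stoppedProcess X τ) 𝓕 Q := by
  classical
  have had := stronglyAdapted_stoppedProcess_of_rightContinuous hX.1 hc hτ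
  have hint : ∀ t, Integrable (stoppedProcess X τ t) Q := fun t =>
    (hX.integral_stoppingTime hc (isStoppingTime_stopAt hτ t)).1
  have hmean : ∀ t, ∫ ω, stoppedProcess X τ t ω ∂Q = ∫ ω, X ⊤ ω ∂Q := fun t =>
    (hX.integral_stoppingTime hc (isStoppingTime_stopAt hτ t)).2
  refine ⟨had, fun s t hst => ?_⟩
  refine (ae_eq_condExp_of_forall_setIntegral_eq (𝓕.le s) (hint t)
    (fun A _ _ => (hint s).integrableOn) (fun A hA _ => ?_)
    (had s).aestronglyMeasurable).symm
  have hAm : MeasurableSet A := 𝓕.le s A hA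
  -- The time is `s ∧ τ` on `A` and `t ∧ τ` off `A`. Comparing its mean with that of `t ∧ τ` cancels
  -- the part off `A` and leaves the martingale identity on `A`.
  have hρ : IsStoppingTime 𝓕 fun ω =>
      ((if ω ∈ A then stopAt τ s ω else stopAt τ t ω : TimeInterval T) :
        WithTop (TimeInterval T)) := by
    have := (isStoppingTime_piecewise_const (𝒢 := 𝓕) hst hA).min hτ
    convert! this using 1
    funext ω
    by_cases hω : ω ∈ A <;> simp [hω, coe_stopAt]
  have h1 := (hX.integral_stoppingTime hc hρ).2
  have h2 : (fun ω => X (if ω ∈ A then stopAt τ s ω else stopAt τ t ω) ω) =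
      A.indicator (stoppedProcess X τ s) + Aᶜ.indicator (stoppedProcess X τ t) := by
    funext ω
    by_cases hω : ω ∈ A <;> simp [hω, stoppedProcess_eq_stopAt]
  rw [h2, integral_add' ((hint s).indicator hAm) ((hint t).indicator hAm.compl),
    integral_indicator hAm, integral_indicator hAm.compl] at h1
  have h3 := integral_add_compl hAm (hint t)
  rw [hmean t] at h3
  linarith

theorem MeasureTheory.Martingale.indicator_of_measurableSet_bot [IsFiniteMeasure Q]
    (hX : Martingale X 𝓕 Q) {A : Set Ω} (hA : MeasurableSet[𝓕 ⊥] A) :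
    Martingale (fun t => A.indicator (X t)) 𝓕 Q := by
  refine ⟨fun t => (hX.1 t).indicator (𝓕.mono bot_le _ hA), fun s t hst => ?_⟩
  refine (condExp_indicator (hX.integrable t) (𝓕.mono bot_le _ hA)).trans ?_
  filter_upwards [hX.2 s t hst] with ω hω
  by_cases h : ω ∈ A <;> simp [h, hω]

theorem measurableSet_bot_lt (hτ : IsStoppingTime 𝓕 τ) :
    MeasurableSet[𝓕 ⊥] {ω | ((⊥ : TimeInterval T) : WithTop (TimeInterval T)) < τ ω} :=
  hτ.measurableSet_gt ⊥

/-- Optional stopping in the form used for localization. -/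
theorem martingale_stoppedProcess_indicator [IsFiniteMeasure Q]
    (hX : Martingale X 𝓕 Q)
    (hc : ∀ ω t, ContinuousWithinAt (fun s => X s ω) (Set.Ici t) t) (hτ : IsStoppingTime 𝓕 τ) :
    Martingale (stoppedProcess (fun i => {ω | ⊥ < τ ω}.indicator (X i)) τ) 𝓕 Q := by
  rw [stoppedProcess_indicator_comm']
  exact (martingale_stoppedProcess_of_rightContinuous hX hc hτ).indicator_of_measurableSet_bot
    (measurableSet_bot_lt hτ)

end OptionalStopping

/-! ### Hitting times of levels by continuous paths -/

section LevelTime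

variable {T : ℝ≥0}

instance TimeInterval.instCompactSpace : CompactSpace (TimeInterval T) := by
  have : Set.Iic T = Set.Icc ⊥ T := Set.Icc_bot.symm
  exact isCompact_iff_compactSpace.1 (this ▸ isCompact_Icc)

open Classical in
/-- The first time at which the path `x` reaches the level `c`, and `⊤` if it never does. -/
noncomputable def levelTime (x : TimeInterval T → ℝ) (c : ℝ) : WithTop (TimeInterval T) :=
  if h : ∃ t, IsLeast {s | c ≤ x s} t then (h.choose : WithTop (TimeInterval T)) else ⊤

variable {x : TimeInterval T → ℝ} {c c' : ℝ} {t : TimeInterval T}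

theorem levelTime_le_iff (hx : Continuous x) :
    levelTime x c ≤ t ↔ ∃ s ≤ t, c ≤ x s := by
  by_cases h : ∃ s, c ≤ x s
  · have hl : ∃ t, IsLeast {s | c ≤ x s} t :=
      (isClosed_le continuous_const hx).isCompact.exists_isLeast h
    rw [levelTime, dif_pos hl, WithTop.coe_le_coe]
    exact ⟨fun hle => ⟨_, hle, hl.choose_spec.1⟩, fun ⟨s, hst, hs⟩ =>
      (hl.choose_spec.2 hs).trans hst⟩
  · have hl : ¬ ∃ t, IsLeast {s | c ≤ x s} t := fun ⟨t, ht⟩ => h ⟨t, ht.1⟩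
    rw [levelTime, dif_neg hl]
    simp only [top_le_iff, WithTop.coe_ne_top, false_iff]
    exact fun ⟨s, _, hs⟩ => h ⟨s, hs⟩

theorem lt_levelTime_iff (hx : Continuous x) :
    t < levelTime x c ↔ ∀ s ≤ t, x s < c := by
  rw [← not_le, levelTime_le_iff hx]
  push Not
  rfl

theorem levelTime_mono (hx : Continuous x) (h : c ≤ c') : levelTime x c ≤ levelTime x c' := by
  induction h' : levelTime x c' with
  | top => exact le_top
  | coe u =>
    obtain ⟨s, hsu, hs⟩ := (levelTime_le_iff hx).1 h'.le
    exact (levelTime_le_iff hx).2 ⟨s, hsu, h.trans hs⟩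

/-- Values before the hitting time are below `c`, and left limits cover the hitting time itself.
Positivity of that time excludes a path starting above `c`. -/
theorem le_of_le_levelTime (hx : Continuous x) (hpos : ((⊥ : TimeInterval T) :
    WithTop (TimeInterval T)) < levelTime x c) (ht : t ≤ levelTime x c) : x t ≤ c := by
  have hlt : ∀ s < t, x s < c := fun s hs =>
    (lt_levelTime_iff hx).1 ((WithTop.coe_lt_coe.2 hs).trans_le ht) s le_rfl
  rcases eq_or_lt_of_le (bot_le : ⊥ ≤ t) with rfl | h0
  · exact ((lt_levelTime_iff hx).1 hpos _ le_rfl).le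
  · have : (𝓝[<] t).NeBot := nhdsLT_neBot_of_exists_lt ⟨⊥, h0⟩
    refine le_of_tendsto (hx.continuousAt.tendsto.mono_left nhdsWithin_le_nhds :
      Tendsto x (𝓝[<] t) (𝓝 (x t))) ?_
    filter_upwards [self_mem_nhdsWithin] with s hs using (hlt s hs).le

theorem lt_levelTime_of_le_levelTime (hx : Continuous x) (hc : c < c')
    (hpos : ((⊥ : TimeInterval T) : WithTop (TimeInterval T)) < levelTime x c)
    (ht : t ≤ levelTime x c) : t < levelTime x c' :=
  (lt_levelTime_iff hx).2 fun _ hs =>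
    (le_of_le_levelTime hx hpos ((WithTop.coe_le_coe.2 hs).trans ht)).trans_lt hc

theorem exists_levelTime_eq_top (hx : Continuous x) :
    ∃ n₀ : ℕ, ∀ n ≥ n₀, levelTime x n = ⊤ := by
  obtain ⟨M, hM⟩ := (isCompact_range hx).bddAbove
  obtain ⟨n₀, hn₀⟩ := exists_nat_gt M
  refine ⟨n₀, fun n hn => ?_⟩
  have h : ((⊤ : TimeInterval T) : WithTop (TimeInterval T)) < levelTime x n :=
    (lt_levelTime_iff hx).2 fun s _ =>
      ((hM ⟨s, rfl⟩).trans_lt hn₀).trans_le (by exact_mod_cast hn)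
  induction h' : levelTime x n with
  | top => rfl
  | coe u => exact absurd (h' ▸ h) (by simp)

/-- By compactness, the level is reached by time `t` exactly when the path up to `t` exceeds every
`c - 1 / (k + 1)`. By continuity, countably many times `min d t` detect this. -/
theorem isStoppingTime_levelTime {Ω : Type*} {mΩ : MeasurableSpace Ω}
    {𝓕 : Filtration (TimeInterval T) mΩ} {S : TimeInterval T → Ω → ℝ}
    (hS : StronglyAdapted 𝓕 S) (hc : ∀ ω, Continuous fun t => S t ω) (c : ℝ) :
    IsStoppingTime 𝓕 fun ω => levelTime (fun t => S t ω) c := by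
  intro t
  have : {ω | levelTime (fun t => S t ω) c ≤ t} =
      ⋂ k : ℕ, ⋃ d ∈ dyadicTimes T, {ω | c - 1 / ((k : ℝ) + 1) < S (min d t) ω} := by
    ext ω
    simp only [Set.mem_ofPred_eq, levelTime_le_iff (hc ω), Set.mem_iInter, Set.mem_iUnion,
      exists_prop]
    constructor
    · rintro ⟨s, hst, hs⟩ k
      have hk : c - 1 / ((k : ℝ) + 1) < S (min s t) ω := by
        rw [min_eq_left hst]
        have : (0 : ℝ) < 1 / ((k : ℝ) + 1) := by positivity
        linarith
      have hlim : Tendsto (fun j => S (min (dyadicSucc j s) t) ω) atTop (𝓝 (S (min s t) ω)) :=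
        ((hc ω).tendsto _).comp ((tendsto_dyadicSucc s).min tendsto_const_nhds)
      obtain ⟨j, hj⟩ := (hlim.eventually (lt_mem_nhds hk)).exists
      exact ⟨_, dyadicSucc_mem j s, hj⟩
    · intro h
      obtain ⟨s, hs, hmax⟩ := (isClosed_Iic (a := t)).isCompact.exists_isMaxOn ⟨t, Set.self_mem_Iic⟩
        (hc ω).continuousOn
      refine ⟨s, hs, ?_⟩
      refine le_of_tendsto' (f := fun k : ℕ => c - 1 / ((k : ℝ) + 1)) (x := atTop) ?_ fun k => ?_
      · simpa using tendsto_const_nhds.sub (tendsto_one_div_add_atTop_nhds_zero_nat (𝕜 := ℝ))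
      · obtain ⟨d, -, hd⟩ := h k
        exact hd.le.trans (hmax (min_le_right d t))
  rw [this]
  refine MeasurableSet.iInter fun k => MeasurableSet.biUnion countable_dyadicTimes fun d _ => ?_
  exact measurableSet_lt measurable_const
    ((hS (min d t)).mono (𝓕.mono (min_le_right _ _))).measurable

end LevelTime

/-! ### Bayes' formula and conditional expectations of series -/

section ConditionalExpectation

variable {Ω : Type*} {m mΩ : MeasurableSpace Ω}

/-- **Bayes' formula** for conditional expectations. -/
theorem condExp_rnDeriv_mul {P Q : Measure Ω} [IsProbabilityMeasure P] [IsProbabilityMeasure Q]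
    (hm : m ≤ mΩ) (hQP : Q ≪ P) {f : Ω → ℝ} (hf : Integrable f Q) :
    P[fun ω => (Q.rnDeriv P ω).toReal * f ω | m] =ᵐ[P]
      P[fun ω => (Q.rnDeriv P ω).toReal | m] * Q[f | m] := by
  have hL : Integrable (fun ω => (Q.rnDeriv P ω).toReal) P := Measure.integrable_toReal_rnDeriv
  have h1 : Integrable (fun ω => (Q.rnDeriv P ω).toReal * f ω) P :=
    (integrable_rnDeriv_smul_iff hQP).2 hf
  have h2 : Integrable (fun ω => (Q.rnDeriv P ω).toReal * Q[f | m] ω) P :=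
    (integrable_rnDeriv_smul_iff hQP).2 integrable_condExp
  have h3 := condExp_mul_of_stronglyMeasurable_right (μ := P) (m := m)
    (f := fun ω => (Q.rnDeriv P ω).toReal) (g := Q[f | m]) stronglyMeasurable_condExp h2 hL
  refine EventuallyEq.trans (EventuallyEq.symm ?_) h3
  refine ae_eq_condExp_of_forall_setIntegral_eq hm h1
    (fun _ _ _ => integrable_condExp.integrableOn) (fun A hA _ => ?_)
    stronglyMeasurable_condExp.aestronglyMeasurable
  refine (setIntegral_condExp hm h2 hA).trans ?_
  -- Over `A`, both `P`-integrals become `Q`-integrals, and those of `f` and `Q[f | m]` agree.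
  have e1 := setIntegral_rnDeriv_smul (f := f) hQP (hm A hA)
  have e2 := setIntegral_rnDeriv_smul (f := Q[f | m]) hQP (hm A hA)
  simp only [smul_eq_mul] at e1 e2
  exact e2.trans ((setIntegral_condExp hm hf hA).trans e1.symm)

/-- The conditional expectation of an absolutely convergent series. -/
theorem ae_hasSum_condExp {P : Measure Ω} [IsFiniteMeasure P] (hm : m ≤ mΩ) {f : ℕ → Ω → ℝ}
    {g : Ω → ℝ} (hf : ∀ n, Integrable (f n) P) (hs : Summable fun n => ∫ ω, ‖f n ω‖ ∂P)
    (hg : ∀ᵐ ω ∂P, HasSum (fun n => f n ω) (g ω)) :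
    ∀ᵐ ω ∂P, HasSum (fun n => P[f n | m] ω) (P[g | m] ω) := by
  let F : ℕ → Lp ℝ 1 P := fun n => (hf n).toL1
  have hF : Summable fun n => ‖F n‖ := by
    refine hs.congr fun n => ?_
    rw [← L1.norm_of_fun_eq_integral_norm]
  let A := condExpL1CLM ℝ hm P
  have hAF : Summable fun n => ‖A (F n)‖ :=
    Summable.of_nonneg_of_le (fun n => norm_nonneg _) (fun n => A.le_opNorm _)
      (hF.mul_left ‖A‖)
  have h1 := Lp.hasSum_coeFn_tsum (f := F) (tsum_enorm_ne_top_iff_summable_norm.2 hF)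
  have h2 := Lp.hasSum_coeFn_tsum (f := fun n => A (F n))
    (tsum_enorm_ne_top_iff_summable_norm.2 hAF)
  rw [← A.map_tsum hF.of_norm] at h2
  have hgF : g =ᵐ[P] (∑' n, F n : Lp ℝ 1 P) := by
    filter_upwards [h1, hg, ae_all_iff.2 fun n => (hf n).coeFn_toL1] with ω a1 a2 a3
    refine a2.unique ?_
    simpa only [F, a3] using a1
  have hgi : Integrable g P := (L1.integrable_coeFn _).congr hgF.symm
  have hgt : hgi.toL1 g = ∑' n, F n :=
    Lp.ext (hgi.coeFn_toL1.trans hgF)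
  filter_upwards [h2, condExp_ae_eq_condExpL1CLM hm hgi,
    ae_all_iff.2 fun n => condExp_ae_eq_condExpL1CLM hm (hf n)] with ω a1 a2 a3
  rw [a2, hgt]
  simpa only [a3] using a1

end ConditionalExpectation

/-! ### Bounded stopping of local martingales -/

section LocalMartingale

variable {Ω : Type*} {mΩ : MeasurableSpace Ω} {T : ℝ≥0} {Q : Measure Ω}
  {𝓕 : Filtration (TimeInterval T) mΩ} {X : TimeInterval T → Ω → ℝ}

theorem continuous_stopAt {τ : Ω → WithTop (TimeInterval T)} (ω : Ω) :
    Continuous fun t => stopAt τ t ω := by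
  induction h : τ ω with
  | top =>
    have : (fun t => stopAt τ t ω) = id := funext fun t => stopAt_of_le (h ▸ le_top)
    exact this ▸ continuous_id
  | coe u =>
    have : (fun t => stopAt τ t ω) = fun t => min t u := funext fun t => by
      rw [← WithTop.coe_inj, coe_stopAt, h, WithTop.coe_min]
    exact this ▸ continuous_id.min continuous_const

theorem stopAt_mono {τ : Ω → WithTop (TimeInterval T)} (ω : Ω) :
    Monotone fun t => stopAt τ t ω := fun s t hst => by
  rw [← WithTop.coe_le_coe, coe_stopAt, coe_stopAt]
  exact min_le_min_right _ (WithTop.coe_le_coe.2 hst)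

theorem continuousWithinAt_stoppedProcess
    (hc : ∀ ω t, ContinuousWithinAt (fun s => X s ω) (Set.Ici t) t)
    (τ : Ω → WithTop (TimeInterval T)) (ω : Ω) (t : TimeInterval T) :
    ContinuousWithinAt (fun s => stoppedProcess X τ s ω) (Set.Ici t) t :=
  ContinuousWithinAt.comp (f := fun s => stopAt τ s ω) (t := Set.Ici (stopAt τ t ω))
    (hc ω (stopAt τ t ω)) (continuous_stopAt ω).continuousWithinAt fun _ hs => stopAt_mono ω hs

theorem continuousWithinAt_indicator
    (hc : ∀ ω t, ContinuousWithinAt (fun s => X s ω) (Set.Ici t) t) (A : Set Ω) (ω : Ω)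
    (t : TimeInterval T) :
    ContinuousWithinAt (fun s => A.indicator (X s) ω) (Set.Ici t) t := by
  by_cases h : ω ∈ A
  · simpa [h] using hc ω t
  · simpa [h] using continuousWithinAt_const

theorem eventually_eq_top_of_tendsto {x : ℕ → WithTop (TimeInterval T)}
    (hx : Tendsto x atTop (𝓝 ⊤)) : ∀ᶠ k in atTop, x k = ⊤ := by
  filter_upwards [hx.eventually (lt_mem_nhds (WithTop.coe_lt_top (⊤ : TimeInterval T)))] with k hk
  induction h : x k with
  | top => rfl
  | coe u => exact absurd (h ▸ hk) (by simp)

/-- A local martingale that is bounded up to the stopping time `σ` is a martingale when stopped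
at `σ`. -/
theorem IsLocalMartingale.martingale_stopped [IsFiniteMeasure Q]
    (hX : IsLocalMartingale X 𝓕 Q) {σ : Ω → WithTop (TimeInterval T)} (hσ : IsStoppingTime 𝓕 σ)
    {K : ℝ} (hK0 : 0 ≤ K)
    (hK : ∀ᵐ ω ∂Q, ((⊥ : TimeInterval T) : WithTop (TimeInterval T)) < σ ω →
      ∀ s : TimeInterval T, s ≤ σ ω → |X s ω| ≤ K) :
    Martingale (stoppedProcess (fun i => {ω | ⊥ < σ ω}.indicator (X i)) σ) 𝓕 Q ∧
      ∀ᵐ ω ∂Q, ∀ t, |(stoppedProcess (fun i => {ω | ⊥ < σ ω}.indicator (X i)) σ) t ω| ≤ K := by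
  obtain ⟨τ, hτ, hM⟩ := hX.locally_martingale
  have hXc : ∀ ω t, ContinuousWithinAt (fun s => X s ω) (Set.Ici t) t := fun ω t =>
    (hX.cadlag ω t).1
  set Y := fun k => stoppedProcess (fun i => {ω | ⊥ < τ k ω}.indicator (X i)) (τ k) with hY
  set Z := fun k => stoppedProcess (fun i => {ω | ⊥ < σ ω}.indicator (Y k i)) σ with hZ
  set W := stoppedProcess (fun i => {ω | ⊥ < σ ω}.indicator (X i)) σ with hW
  have hZm : ∀ k, Martingale (Z k) 𝓕 Q := fun k =>
    martingale_stoppedProcess_indicator (hM k)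
      (continuousWithinAt_stoppedProcess (continuousWithinAt_indicator hXc _) _) hσ
  have hWad : StronglyAdapted 𝓕 W :=
    stronglyAdapted_stoppedProcess_of_rightContinuous
      (fun t => (hX.adapted t).indicator (𝓕.mono bot_le _ (measurableSet_bot_lt hσ)))
      (continuousWithinAt_indicator hXc _) hσ
  have hlim : ∀ᵐ ω ∂Q, ∀ t, Tendsto (fun k => Z k t ω) atTop (𝓝 (W t ω)) := by
    filter_upwards [hτ.tendsto_top] with ω hω t
    refine tendsto_const_nhds.congr' ?_
    filter_upwards [eventually_eq_top_of_tendsto hω] with k hk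
    have hYX : ∀ s, Y k s ω = X s ω := fun s => by
      simp only [hY, stoppedProcess_eq_stopAt, stopAt_of_le (hk ▸ le_top : (s : WithTop _) ≤ τ k ω)]
      rw [Set.indicator_of_mem]
      simp [hk]
    simp only [hZ, hW, stoppedProcess_eq_stopAt]
    by_cases hb : ω ∈ {ω | (⊥ : WithTop (TimeInterval T)) < σ ω}
    · rw [Set.indicator_of_mem hb, Set.indicator_of_mem hb, hYX]
    · rw [Set.indicator_of_notMem hb, Set.indicator_of_notMem hb]
  have hZb : ∀ᵐ ω ∂Q, ∀ k t, |Z k t ω| ≤ K := by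
    filter_upwards [hK] with ω hω k t
    simp only [hZ, hY, stoppedProcess_eq_stopAt, Set.indicator_apply]
    split_ifs with h1 h2
    · refine hω h1 _ ?_
      have : (stopAt (τ k) (stopAt σ t ω) ω : WithTop (TimeInterval T)) ≤ stopAt σ t ω :=
        WithTop.coe_le_coe.2 (stopAt_le _ _)
      exact this.trans (coe_stopAt t ω ▸ min_le_right _ _)
    · simpa using hK0
    · simpa using hK0
  have hWb : ∀ᵐ ω ∂Q, ∀ t, |W t ω| ≤ K := by
    filter_upwards [hlim, hZb] with ω h1 h2 t
    exact le_of_tendsto (h1 t).abs (.of_forall fun k => h2 k t)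
  have hWi : ∀ t, Integrable (W t) Q := fun t =>
    .of_bound (hWad.stronglyMeasurable).aestronglyMeasurable K (hWb.mono fun ω h => h t)
  refine ⟨⟨hWad, fun s t hst => ?_⟩, hWb⟩
  -- `Z k`, stopped at both `τ k` and `σ`, is a martingale bounded by `K` and almost surely equals
  -- `W` for large `k`, so dominated convergence applies.
  have := tendsto_condExp_unique (m := 𝓕 s) (μ := Q) (fun k => Z k t) (fun k => Z k s) (W t) (W s)
    (fun k => (hZm k).integrable t) (fun k => (hZm k).integrable s)
    (hlim.mono fun ω h => h t) (hlim.mono fun ω h => h s) (fun _ => K) (integrable_const _)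
    (fun _ => K) (integrable_const _) (fun k => hZb.mono fun ω h => h k t)
    (fun k => hZb.mono fun ω h => h k s) fun k =>
      ((hZm k).2 s t hst).trans ((hZm k).2 s s le_rfl).symm
  rwa [condExp_of_stronglyMeasurable (𝓕.le s) (hWad s) (hWi s)] at this

/-- Right-continuity turns almost sure bounds at countably many times into one null set for all
times. As `lam` may exceed one, the lower bid bound may be negative, hence the factor `1 + lam`. -/
theorem IsConsistentPriceSystem.ae_abs_le {P : Measure Ω} {S : TimeInterval T → Ω → ℝ} {lam : ℝ}
    (h : IsConsistentPriceSystem P 𝓕 S lam Q X) (hS_cont : ∀ ω, Continuous fun t => S t ω)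
    (hS_pos : ∀ t ω, 0 < S t ω) (hlam : 0 < lam) :
    ∀ᵐ ω ∂P, ∀ t, |X t ω| ≤ (1 + lam) * S t ω := by
  filter_upwards [(ae_ball_iff countable_dyadicTimes).2 fun d _ => h.bidAsk d] with ω hω t
  have hd : ∀ d ∈ dyadicTimes T, |X d ω| ≤ (1 + lam) * S d ω := fun d hd => by
    have h1 := hω d hd
    have h2 := hS_pos d ω
    have h3 := mul_pos hlam h2
    rw [abs_le]
    constructor <;> nlinarith
  refine le_of_tendsto_of_tendsto' (b := atTop)
    (((h.isLocalMartingale.cadlag ω t).1.tendsto.comp (tendsto_dyadicSucc_nhdsGE t)).abs)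
    ((((hS_cont ω).tendsto t).comp (tendsto_dyadicSucc t)).const_mul (1 + lam))
    fun j => hd _ (dyadicSucc_mem j t)

end LocalMartingale

/-! ### Densities of mixtures -/

section Mixture

variable {Ω : Type*} {mΩ : MeasurableSpace Ω} {P : Measure Ω} {α : ℕ → ℝ} {Q : ℕ → Measure Ω}

theorem isProbabilityMeasure_mixture (hQ : ∀ m, IsProbabilityMeasure (Q m))
    (hα_nonneg : ∀ m, 0 ≤ α m) (hα_sum : HasSum α 1) : IsProbabilityMeasure (mixture α Q) := by
  refine ⟨?_⟩
  simp only [mixture, Measure.sum_apply _ MeasurableSet.univ, Measure.smul_apply, measure_univ,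
    smul_eq_mul, mul_one]
  rw [← ENNReal.ofReal_tsum_of_nonneg hα_nonneg hα_sum.summable, hα_sum.tsum_eq,
    ENNReal.ofReal_one]

theorem mixture_absolutelyContinuous (hQ : ∀ m, Q m ≪ P) : mixture α Q ≪ P := by
  refine Measure.AbsolutelyContinuous.mk fun s _ hs => ?_
  rw [mixture, Measure.sum_apply_eq_zero]
  intro m
  simp [hQ m hs]

theorem absolutelyContinuous_mixture (hQ : ∀ m, P ≪ Q m) (hα_nonneg : ∀ m, 0 ≤ α m)
    (hα_sum : HasSum α 1) : P ≪ mixture α Q := by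
  obtain ⟨m, hm⟩ : ∃ m, 0 < α m := by
    by_contra! h
    have : α = 0 := funext fun m => le_antisymm (h m) (hα_nonneg m)
    exact zero_ne_one (hasSum_zero.unique (this ▸ hα_sum))
  intro s hs
  rw [mixture, Measure.sum_apply_eq_zero] at hs
  refine hQ m ?_
  simpa [hm.not_ge] using hs m

theorem ae_hasSum_rnDeriv_mixture [IsProbabilityMeasure P] (hQ : ∀ m, IsProbabilityMeasure (Q m))
    (hQP : ∀ m, Q m ≪ P) (hα_nonneg : ∀ m, 0 ≤ α m) (hα_sum : HasSum α 1) :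
    ∀ᵐ ω ∂P, HasSum (fun m => α m * ((Q m).rnDeriv P ω).toReal)
      ((mixture α Q).rnDeriv P ω).toReal := by
  have := isProbabilityMeasure_mixture hQ hα_nonneg hα_sum
  have hmeas : ∀ m, Measurable (ENNReal.ofReal (α m) • (Q m).rnDeriv P) := fun m =>
    (Measure.measurable_rnDeriv _ _).const_smul _
  have hmix : mixture α Q = P.withDensity (∑' m, ENNReal.ofReal (α m) • (Q m).rnDeriv P) := by
    rw [withDensity_tsum hmeas, mixture]
    congr 1
    funext m
    rw [withDensity_smul _ (Measure.measurable_rnDeriv _ _),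
      Measure.withDensity_rnDeriv_eq _ _ (hQP m)]
  have hd : (mixture α Q).rnDeriv P =ᵐ[P] ∑' m, ENNReal.ofReal (α m) • (Q m).rnDeriv P := by
    conv_lhs => rw [hmix]
    refine Measure.rnDeriv_withDensity P ?_
    have := Measurable.tsum (L := .unconditional ℕ) hmeas
    convert! this using 1
    funext ω
    exact ENNReal.tsum_apply
  filter_upwards [hd, Measure.rnDeriv_lt_top (mixture α Q) P] with ω h1 h2
  rw [h1, ENNReal.tsum_apply] at h2
  rw [h1, ENNReal.tsum_apply]
  have h3 := ENNReal.hasSum_toReal h2.ne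
  rw [← ENNReal.tsum_toReal_eq fun m => ENNReal.ne_top_of_tsum_ne_top h2.ne m] at h3
  simpa [ENNReal.toReal_ofReal, hα_nonneg] using h3

variable {T : ℝ≥0} {𝓕 : Filtration (TimeInterval T) mΩ}

theorem integral_toReal_rnDeriv_eq_one {P Q : Measure Ω} [IsProbabilityMeasure P]
    [IsProbabilityMeasure Q] (hQP : Q ≪ P) : ∫ ω, (Q.rnDeriv P ω).toReal ∂P = 1 := by
  rw [Measure.integral_toReal_rnDeriv hQP]
  simp

theorem ae_hasSum_densityProcess_mixture [IsProbabilityMeasure P]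
    (hQ : ∀ m, IsProbabilityMeasure (Q m)) (hQP : ∀ m, Q m ≪ P) (hα_nonneg : ∀ m, 0 ≤ α m)
    (hα_sum : HasSum α 1) (t : TimeInterval T) :
    ∀ᵐ ω ∂P, HasSum (fun m => α m * densityProcess P 𝓕 (Q m) t ω)
      (densityProcess P 𝓕 (mixture α Q) t ω) := by
  have h1 := ae_hasSum_condExp (𝓕.le t)
    (f := fun m ω => α m * ((Q m).rnDeriv P ω).toReal)
    (fun m => Measure.integrable_toReal_rnDeriv.const_mul _) ?_
    (ae_hasSum_rnDeriv_mixture hQ hQP hα_nonneg hα_sum)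
  · filter_upwards [h1, ae_all_iff.2 fun m =>
      condExp_smul (μ := P) (α m) (fun ω => ((Q m).rnDeriv P ω).toReal) (𝓕 t)] with ω a1 a2
    convert! a1 using 1
    funext m
    exact (a2 m).symm
  · refine hα_sum.summable.congr fun m => ?_
    simp only [norm_mul, Real.norm_of_nonneg (hα_nonneg m), ENNReal.toReal_nonneg,
      Real.norm_of_nonneg]
    rw [integral_const_mul, integral_toReal_rnDeriv_eq_one (hQP m), mul_one]

/-- The `Q`-mass of the event where the density process is nonpositive is its `P`-integral there,
hence zero; `P ≪ Q` transfers this to `P`. -/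
theorem ae_densityProcess_pos {P Q : Measure Ω} [IsProbabilityMeasure P] [IsProbabilityMeasure Q]
    (hQP : Q ≪ P) (hPQ : P ≪ Q) (t : TimeInterval T) :
    ∀ᵐ ω ∂P, 0 < densityProcess P 𝓕 Q t ω := by
  have hm : MeasurableSet[𝓕 t] {ω | densityProcess P 𝓕 Q t ω ≤ 0} :=
    (stronglyMeasurable_condExp.measurable : Measurable[𝓕 t] (densityProcess P 𝓕 Q t))
      measurableSet_Iic
  have h1 := setIntegral_condExp (𝓕.le t) (μ := P)
    (Measure.integrable_toReal_rnDeriv (μ := Q) (ν := P)) hm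
  rw [Measure.setIntegral_toReal_rnDeriv hQP] at h1
  have h2 : Q.real {ω | densityProcess P 𝓕 Q t ω ≤ 0} ≤ 0 := by
    rw [← h1]
    exact setIntegral_nonpos (𝓕.le t _ hm) fun ω hω => hω
  have h3 : Q {ω | densityProcess P 𝓕 Q t ω ≤ 0} = 0 :=
    (measureReal_eq_zero_iff).1 (le_antisymm h2 measureReal_nonneg)
  rw [ae_iff]
  simpa using hPQ h3

end Mixture

/-! ### Mixing and gluing price systems -/

section PriceSystems

variable {Ω : Type*} {mΩ : MeasurableSpace Ω} {P : Measure Ω} {T : ℝ≥0}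
  {𝓕 : Filtration (TimeInterval T) mΩ} {α : ℕ → ℝ} {Q : ℕ → Measure Ω}

theorem UsualConditions.of_absolutelyContinuous {Q : Measure Ω} (h : UsualConditions 𝓕 P)
    (hPQ : P ≪ Q) : UsualConditions 𝓕 Q :=
  ⟨h.rightContinuous, fun s hs => h.complete s (hPQ hs)⟩

/-- Uniformly bounded martingales under the measures `Q m` combine, with the weights
`α m * Z^m / Z`, to a càdlàg martingale under the mixture. -/
theorem exists_cadlag_martingale_mixture [IsProbabilityMeasure P] (h𝓕 : UsualConditions 𝓕 P)
    (hQ : ∀ m, IsProbabilityMeasure (Q m)) (hQP : ∀ m, Q m ≪ P) (hPQ : ∀ m, P ≪ Q m)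
    (hα_nonneg : ∀ m, 0 ≤ α m) (hα_sum : HasSum α 1) {Y : ℕ → TimeInterval T → Ω → ℝ}
    (hY : ∀ m, Martingale (Y m) 𝓕 (Q m)) {K : ℝ}
    (hK : ∀ m, ∀ᵐ ω ∂P, ∀ t, |Y m t ω| ≤ K) :
    ∃ X : TimeInterval T → Ω → ℝ, Martingale X 𝓕 (mixture α Q) ∧
      (∀ ω, IsCadlagPath fun t => X t ω) ∧
      ∀ t, ∀ᵐ ω ∂P, HasSum (fun m => α m * Y m t ω * densityProcess P 𝓕 (Q m) t ω /
        densityProcess P 𝓕 (mixture α Q) t ω) (X t ω) := by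
  have hQm := isProbabilityMeasure_mixture hQ hα_nonneg hα_sum
  have hmP := mixture_absolutelyContinuous (α := α) hQP
  have hPm := absolutelyContinuous_mixture hPQ hα_nonneg hα_sum
  set L : ℕ → Ω → ℝ := fun m ω => ((Q m).rnDeriv P ω).toReal with hL
  set LQ : Ω → ℝ := fun ω => ((mixture α Q).rnDeriv P ω).toReal with hLQ
  have hL0 : ∀ m ω, 0 ≤ L m ω := fun m ω => ENNReal.toReal_nonneg
  let f : ℕ → Ω → ℝ := fun m ω => α m * (L m ω * Y m ⊤ ω)
  -- This is the terminal value of the mixed martingale. As `∑ α m * L m = LQ`, dividing by `LQ`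
  -- retains the bound `K`.
  let ξ : Ω → ℝ := fun ω => (∑' m, f m ω) / LQ ω
  have hLsum := ae_hasSum_rnDeriv_mixture hQ hQP hα_nonneg hα_sum
  have hLpos : ∀ᵐ ω ∂P, 0 < LQ ω := by
    filter_upwards [hPm.ae_le (Measure.rnDeriv_pos hmP), Measure.rnDeriv_lt_top (mixture α Q) P]
      with ω h1 h2 using ENNReal.toReal_pos h1.ne' h2.ne
  have hfle : ∀ᵐ ω ∂P, ∀ m, |f m ω| ≤ α m * L m ω * K := by
    filter_upwards [ae_all_iff.2 hK] with ω hω m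
    rw [abs_mul, abs_mul, abs_of_nonneg (hα_nonneg m), abs_of_nonneg (hL0 m ω), mul_assoc]
    exact mul_le_mul_of_nonneg_left (mul_le_mul_of_nonneg_left (hω m ⊤) (hL0 m ω)) (hα_nonneg m)
  have hfsum : ∀ᵐ ω ∂P, HasSum (fun m => f m ω) (∑' m, f m ω) ∧ |∑' m, f m ω| ≤ LQ ω * K := by
    filter_upwards [hfle, hLsum] with ω h1 h2
    have h3 := h2.mul_right K
    have h4 : Summable fun m => ‖f m ω‖ := h3.summable.of_nonneg_of_le (fun _ => norm_nonneg _) h1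
    exact ⟨h4.of_norm.hasSum, tsum_of_norm_bounded (f := fun m => f m ω) h3 h1⟩
  have hξ : ∀ᵐ ω ∂P, |ξ ω| ≤ K := by
    filter_upwards [hfsum, hLpos] with ω h1 h2
    rw [abs_div, abs_of_pos h2, div_le_iff₀ h2, mul_comm K]
    exact h1.2
  have hYi : ∀ m, Integrable (Y m ⊤) (Q m) := fun m => (hY m).integrable ⊤
  have hLY : ∀ m, Integrable (fun ω => L m ω * Y m ⊤ ω) P := fun m =>
    (integrable_rnDeriv_smul_iff (hQP m)).2 (hYi m)
  have hfi : ∀ m, Integrable (f m) P := fun m => (hLY m).const_mul _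
  have hfm : ∀ m, Measurable (f m) := fun m =>
    (((Measure.measurable_rnDeriv _ _).ennreal_toReal).mul
      (((hY m).1 ⊤).mono (𝓕.le ⊤)).measurable).const_mul _
  have hξm : Measurable ξ := by
    refine Measurable.div ?_ (Measure.measurable_rnDeriv _ _).ennreal_toReal
    exact Measurable.tsum (L := .unconditional ℕ) hfm
  have hξi : Integrable ξ (mixture α Q) :=
    .of_bound hξm.aestronglyMeasurable K (hmP.ae_le hξ)
  obtain ⟨X, hXad, hXc, hX⟩ := (h𝓕.of_absolutelyContinuous hPm).exists_cadlag_condExp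
    (hmP.ae_le hξ)
  refine ⟨X, ⟨hXad, fun s t hst => ?_⟩, hXc, fun t => ?_⟩
  · exact (condExp_congr_ae (hX t)).trans ((𝓕.condExp_condExp ξ hst).trans (hX s).symm)
  · have hs : Summable fun m => ∫ ω, ‖f m ω‖ ∂P := by
      refine (hα_sum.summable.mul_right K).of_nonneg_of_le
        (fun m => integral_nonneg fun _ => norm_nonneg _) fun m => ?_
      have h1 : ∫ ω, ‖f m ω‖ ∂P ≤ ∫ ω, α m * L m ω * K ∂P :=
        integral_mono_ae (hfi m).norm
          ((Measure.integrable_toReal_rnDeriv.const_mul _).mul_const _)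
          (hfle.mono fun ω h => h m)
      rwa [integral_mul_const, integral_const_mul,
        integral_toReal_rnDeriv_eq_one (hQP m), mul_one] at h1
    -- The conditional `P`-expectation of `LQ * ξ` is evaluated twice: term by term with Bayes under
    -- each `Q m`, and as a whole with Bayes under the mixture.
    have hsum := ae_hasSum_condExp (𝓕.le t) (g := fun ω => LQ ω * ξ ω) hfi hs (by
      filter_upwards [hfsum, hLpos] with ω h1 h2
      simp only [ξ, mul_div_cancel₀ _ h2.ne']
      exact h1.1)
    have hf : ∀ m, P[f m | 𝓕 t] =ᵐ[P]
        fun ω => α m * Y m t ω * densityProcess P 𝓕 (Q m) t ω := fun m => by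
      filter_upwards [condExp_smul (μ := P) (α m) (fun ω => L m ω * Y m ⊤ ω) (𝓕 t),
        condExp_rnDeriv_mul (𝓕.le t) (hQP m) (hYi m),
        (hPQ m).ae_le ((hY m).2 t ⊤ le_top)] with ω h1 h2 h3
      refine h1.trans ?_
      rw [Pi.smul_apply, smul_eq_mul, h2, Pi.mul_apply, h3, densityProcess]
      ring
    filter_upwards [hsum, ae_all_iff.2 hf, condExp_rnDeriv_mul (𝓕.le t) hmP hξi,
      hPm.ae_le (hX t), ae_densityProcess_pos (𝓕 := 𝓕) hmP hPm t] with ω h1 h2 h3 h4 h5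
    have h6 : P[fun ω => LQ ω * ξ ω | 𝓕 t] ω / densityProcess P 𝓕 (mixture α Q) t ω = X t ω := by
      rw [h3, Pi.mul_apply, ← h4]
      exact mul_div_cancel_left₀ _ h5.ne'
    rw [← h6]
    simpa only [h2] using h1.div_const (densityProcess P 𝓕 (mixture α Q) t ω)

/-- A mixture of consistent price systems, weighted by the density processes, is a consistent price
system under the mixture of the measures. -/
theorem exists_isConsistentPriceSystem_mixture [IsProbabilityMeasure P]
    (h𝓕 : UsualConditions 𝓕 P) {S : TimeInterval T → Ω → ℝ} (hS_adapted : StronglyAdapted 𝓕 S)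
    (hS_cont : ∀ ω, Continuous fun t => S t ω) (hS_pos : ∀ t ω, 0 < S t ω)
    {lam : ℝ} (hlam : 0 < lam) (hα_nonneg : ∀ m, 0 ≤ α m) (hα_sum : HasSum α 1)
    {Stilde : ℕ → TimeInterval T → Ω → ℝ}
    (h : ∀ m, IsConsistentPriceSystem P 𝓕 S lam (Q m) (Stilde m)) :
    ∃ S' : TimeInterval T → Ω → ℝ,
      IsConsistentPriceSystem P 𝓕 S lam (mixture α Q) S' ∧
      ∀ t, ∀ᵐ ω ∂P, 0 < densityProcess P 𝓕 (mixture α Q) t ω ∧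
        HasSum (fun m => α m * Stilde m t ω * densityProcess P 𝓕 (Q m) t ω /
          densityProcess P 𝓕 (mixture α Q) t ω) (S' t ω) := by
  classical
  have hQ := fun m => (h m).isProbabilityMeasure
  have hQP := fun m => (h m).absolutelyContinuous
  have hPQ := fun m => (h m).absolutelyContinuous'
  have hQm := isProbabilityMeasure_mixture hQ hα_nonneg hα_sum
  have hmP := mixture_absolutelyContinuous (α := α) hQP
  have hPm := absolutelyContinuous_mixture hPQ hα_nonneg hα_sum
  let σ : ℕ → Ω → WithTop (TimeInterval T) := fun n ω => levelTime (fun t => S t ω) n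
  have hσ : ∀ n, IsStoppingTime 𝓕 (σ n) := fun n => isStoppingTime_levelTime hS_adapted hS_cont n
  let Y : ℕ → ℕ → TimeInterval T → Ω → ℝ := fun n m =>
    stoppedProcess (fun i => {ω | ⊥ < σ n ω}.indicator (Stilde m i)) (σ n)
  have hYS : ∀ n m (t : TimeInterval T) ω, t < σ n ω → Y n m t ω = Stilde m t ω := fun n m t ω ht => by
    simp only [Y, stoppedProcess_eq_stopAt, stopAt_of_le ht.le]
    rw [Set.indicator_of_mem]
    exact lt_of_le_of_lt (WithTop.coe_le_coe.2 (bot_le : ⊥ ≤ t)) ht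
  have hYm : ∀ n m, Martingale (Y n m) 𝓕 (Q m) ∧ ∀ᵐ ω ∂Q m, ∀ t, |Y n m t ω| ≤ (1 + lam) * n := by
    intro n m
    refine (h m).isLocalMartingale.martingale_stopped (hσ n) (by positivity) ?_
    filter_upwards [(hQP m).ae_le ((h m).ae_abs_le hS_cont hS_pos hlam)] with ω hω hpos s hs
    exact (hω s).trans (mul_le_mul_of_nonneg_left (le_of_le_levelTime (hS_cont ω) hpos hs)
      (by positivity))
  have hX := fun n => exists_cadlag_martingale_mixture h𝓕 hQ hQP hPQ hα_nonneg hα_sum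
    (fun m => (hYm n m).1) fun m => (hPQ m).ae_le (hYm n m).2
  choose X hXm hXc hXsum using hX
  -- Strictly before `σ n`, both levels sum the same series in the unstopped `Stilde m`. This gives
  -- equality at dyadic times, and right-continuity extends it to all times.
  let G : Set Ω := {ω | ∀ n k, n ≤ k → ∀ t : TimeInterval T, t < σ n ω → X n t ω = X k t ω}
  have hG : ∀ᵐ ω ∂P, ω ∈ G := by
    filter_upwards [(ae_ball_iff countable_dyadicTimes).2 fun d _ =>
      ae_all_iff.2 fun n => hXsum n d] with ω hω n k hnk t ht
    have hd : ∀ d ∈ dyadicTimes T, d < σ n ω → X n d ω = X k d ω := by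
      intro d hd hdn
      have hdk : d < σ k ω := hdn.trans_le (levelTime_mono (hS_cont ω) (by exact_mod_cast hnk))
      have h1 := hω d hd n
      have h2 := hω d hd k
      simp only [hYS _ _ _ _ hdn] at h1
      simp only [hYS _ _ _ _ hdk] at h2
      exact h1.unique h2
    have hlim := fun n => (hXc n ω t).1.tendsto.comp (tendsto_dyadicSucc_nhdsGE t)
    refine tendsto_nhds_unique (hlim n) ((hlim k).congr' ?_)
    have hev : ∀ᶠ s : TimeInterval T in 𝓝 t, (s : WithTop (TimeInterval T)) < σ n ω := by
      induction hs : σ n ω with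
      | top => exact .of_forall fun s => WithTop.coe_lt_top s
      | coe u =>
        rw [hs, WithTop.coe_lt_coe] at ht
        simpa only [WithTop.coe_lt_coe] using gt_mem_nhds ht
    filter_upwards [(tendsto_dyadicSucc t).eventually hev] with j hj
    exact (hd _ (dyadicSucc_mem j t) hj).symm
  let S' : TimeInterval T → Ω → ℝ := fun t ω =>
    if ω ∈ G then limUnder atTop fun n => X n t ω else 0
  have htop : ∀ ω, ∃ n₀, ∀ n ≥ n₀, σ n ω = ⊤ := fun ω => exists_levelTime_eq_top (hS_cont ω)
  have hS'lim : ∀ ω ∈ G, ∀ n (t : TimeInterval T), t < σ n ω → Tendsto (fun n => X n t ω) atTop (𝓝 (X n t ω)) :=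
    fun ω hω n t ht => tendsto_const_nhds.congr'
      ((eventually_ge_atTop n).mono fun k hk => hω n k hk t ht)
  have hS'X : ∀ ω ∈ G, ∀ n (t : TimeInterval T), t < σ n ω → S' t ω = X n t ω := fun ω hω n t ht => by
    simp only [S', if_pos hω]
    exact (hS'lim ω hω n t ht).limUnder_eq
  have hS'top : ∀ ω ∈ G, ∃ n, σ n ω = ⊤ ∧ ∀ t, S' t ω = X n t ω := fun ω hω => by
    obtain ⟨n, hn⟩ := htop ω
    exact ⟨n, hn n le_rfl, fun t => hS'X ω hω n t (hn n le_rfl ▸ WithTop.coe_lt_top t)⟩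
  have hGm : ∀ t, MeasurableSet[𝓕 t] G := fun t =>
    .of_compl (h𝓕.measurableSet_of_null t (mem_ae_iff.1 hG))
  have hS'ad : StronglyAdapted 𝓕 S' := fun t => by
    refine stronglyMeasurable_of_tendsto (m := 𝓕 t) (u := atTop) (f := fun n => G.indicator (X n t))
      (fun n => ((hXm n).1 t).indicator (hGm t)) (tendsto_pi_nhds.2 fun ω => ?_)
    by_cases hω : ω ∈ G
    · obtain ⟨n, hn⟩ := htop ω
      have hlt : t < σ n ω := hn n le_rfl ▸ WithTop.coe_lt_top t
      simpa [hω, hS'X ω hω n t hlt] using hS'lim ω hω n t hlt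
    · simp [hω, S']
  have hS'c : ∀ ω, IsCadlagPath fun t => S' t ω := fun ω => by
    by_cases hω : ω ∈ G
    · obtain ⟨n, -, hn⟩ := hS'top ω hω
      simpa only [hn] using hXc n ω
    · have : (fun t => S' t ω) = fun _ => 0 := funext fun t => by simp [S', hω]
      rw [this]
      exact fun t => ⟨continuousWithinAt_const, 0, tendsto_const_nhds⟩
  have hsum : ∀ t, ∀ᵐ ω ∂P, HasSum (fun m => α m * Stilde m t ω * densityProcess P 𝓕 (Q m) t ω /
      densityProcess P 𝓕 (mixture α Q) t ω) (S' t ω) := fun t => by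
    filter_upwards [hG, ae_all_iff.2 fun n => hXsum n t] with ω hω h1
    obtain ⟨n, hn, hSn⟩ := hS'top ω hω
    have h2 := h1 n
    simp only [hYS _ _ _ _ (hn ▸ WithTop.coe_lt_top t : (t : WithTop _) < σ n ω)] at h2
    rwa [hSn]
  have hpos := fun t => ae_densityProcess_pos (𝓕 := 𝓕) hmP hPm t
  refine ⟨S', ⟨hQm, hmP, hPm, ⟨hS'ad, hS'c, σ, ⟨⟨hσ, ?_⟩, ?_⟩, fun n => ?_⟩, fun t => ?_⟩,
    fun t => (hpos t).and (hsum t)⟩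
  · refine .of_forall fun ω => tendsto_const_nhds.congr' ?_
    obtain ⟨n₀, hn₀⟩ := htop ω
    exact (eventually_ge_atTop n₀).mono fun n hn => (hn₀ n hn).symm
  · exact .of_forall fun ω n k hnk => levelTime_mono (hS_cont ω) (by exact_mod_cast hnk)
  -- Agreement of `S'` with `X n` is known only strictly before `σ n`. Level `n + 1` is reached
  -- strictly later when `σ n` is positive, so `X (n + 1)` represents `S'` up to and including `σ
  -- n`.
  · have hXn := martingale_stoppedProcess_indicator (hXm (n + 1))
      (fun ω t => (hXc (n + 1) ω t).1) (hσ n)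
    have heq : ∀ t, stoppedProcess (fun i => {ω | ⊥ < σ n ω}.indicator (S' i)) (σ n) t
        =ᵐ[mixture α Q]
        stoppedProcess (fun i => {ω | ⊥ < σ n ω}.indicator (X (n + 1) i)) (σ n) t := fun t => by
      filter_upwards [hmP.ae_le hG] with ω hω
      simp only [stoppedProcess_eq_stopAt, Set.indicator_apply]
      split_ifs with hb
      · refine hS'X ω hω _ _ (lt_levelTime_of_le_levelTime (hS_cont ω)
          (Nat.cast_lt.2 n.lt_succ_self) hb ?_)
        exact coe_stopAt t ω ▸ min_le_right _ _
      · rfl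
    refine ⟨stronglyAdapted_stoppedProcess_of_rightContinuous
      (fun t => (hS'ad t).indicator (𝓕.mono bot_le _ (measurableSet_bot_lt (hσ n))))
      (continuousWithinAt_indicator (fun ω t => (hS'c ω t).1) _) (hσ n), fun s t hst => ?_⟩
    exact (condExp_congr_ae (heq t)).trans ((hXn.2 s t hst).trans (heq s).symm)
  · have hnn : ∀ᵐ ω ∂P, ∀ m, 0 < densityProcess P 𝓕 (Q m) t ω :=
      ae_all_iff.2 fun m => ae_densityProcess_pos (hQP m) (hPQ m) t
    filter_upwards [hsum t, hpos t, hnn, ae_all_iff.2 fun m => (h m).bidAsk t,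
      ae_hasSum_densityProcess_mixture (𝓕 := 𝓕) hQ hQP hα_nonneg hα_sum t] with ω h1 h2 h3 h4 h5
    -- The weights sum to one; `c` will be the bid price and then the ask price.
    have hw : ∀ c, HasSum (fun m => α m * c * densityProcess P 𝓕 (Q m) t ω /
        densityProcess P 𝓕 (mixture α Q) t ω) c := fun c => by
      have := (h5.mul_left c).div_const (densityProcess P 𝓕 (mixture α Q) t ω)
      rw [mul_div_cancel_right₀ _ h2.ne'] at this
      convert! this using 2 with m
      ring
    have hmono : ∀ m {a b : ℝ}, a ≤ b → α m * a * densityProcess P 𝓕 (Q m) t ω /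
        densityProcess P 𝓕 (mixture α Q) t ω ≤ α m * b * densityProcess P 𝓕 (Q m) t ω /
        densityProcess P 𝓕 (mixture α Q) t ω := fun m a b hab =>
      div_le_div_of_nonneg_right (mul_le_mul_of_nonneg_right
        (mul_le_mul_of_nonneg_left hab (hα_nonneg m)) (h3 m).le) h2.le
    exact ⟨hasSum_le (fun m => hmono m (h4 m).1) (hw _) h1,
      hasSum_le (fun m => hmono m (h4 m).2) h1 (hw _)⟩

end PriceSystems

theorem corollary5p4 {Ω : Type*} {mΩ : MeasurableSpace Ω} (P : Measure Ω) [IsProbabilityMeasure P]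
    (T : ℝ≥0) (𝓕 : Filtration (TimeInterval T) mΩ) (h𝓕 : UsualConditions 𝓕 P)
    (S : TimeInterval T → Ω → ℝ) (hS_adapted : StronglyAdapted 𝓕 S)
    (hS_cont : ∀ ω, Continuous fun t => S t ω) (hS_pos : ∀ t ω, 0 < S t ω)
    (lam : ℝ) (hlam : 0 < lam)
    (α : ℕ → ℝ) (hα_nonneg : ∀ m, 0 ≤ α m) (hα_sum : HasSum α 1) :
    (∀ Q : ℕ → Measure Ω, (∀ m, Q m ∈ consistentMeasures P 𝓕 S lam) →
      mixture α Q ∈ consistentMeasures P 𝓕 S lam) ∧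
    (∀ (Q : ℕ → Measure Ω) (Stilde : ℕ → TimeInterval T → Ω → ℝ),
      (∀ m, IsConsistentPriceSystem P 𝓕 S lam (Q m) (Stilde m)) →
      ∃ S' : TimeInterval T → Ω → ℝ,
        IsConsistentPriceSystem P 𝓕 S lam (mixture α Q) S' ∧
        ∀ t, ∀ᵐ ω ∂P, 0 < densityProcess P 𝓕 (mixture α Q) t ω ∧
          HasSum (fun m => α m * Stilde m t ω * densityProcess P 𝓕 (Q m) t ω /
            densityProcess P 𝓕 (mixture α Q) t ω) (S' t ω)) := by
  refine ⟨fun Q hQ => ?_, fun Q Stilde h => exists_isConsistentPriceSystem_mixture h𝓕 hS_adapted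
    hS_cont hS_pos hlam hα_nonneg hα_sum h⟩
  choose Stilde h using hQ
  obtain ⟨S', hS', -⟩ := exists_isConsistentPriceSystem_mixture h𝓕 hS_adapted hS_cont hS_pos hlam
    hα_nonneg hα_sum h
  exact ⟨S', hS'⟩
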